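/- For every $\delta>0$ there is $n_0\in\mathbb N$ such that for all integers $n\ge n_0$ and $k$ with $\delta n\le k\le n$ the following holds for every finite simple graph $G$ on $n$ vertices. If the average degree $d(G)=\frac1n\sum_{v\in V(G)}\deg_G(v)$ satisfies $d(G)>(1+\delta)k$, then $G$ contains, as a (not necessarily induced) subgraph, a copy of every tree $T$ with exactly $k$ edges and maximum degree $\Delta(T)\le k^{1/67}$. -/

import Mathlib

/-- The average degree of a finite graph: the sum of the degrees of all vertices divided by the
number of vertices. -/
noncomputable def avgDegree {V : Type*} [Fintype V] (G : SimpleGraph V) [DecidableRel G.Adj] : ℝ :=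
  (∑ v : V, (G.degree v : ℝ)) / (Fintype.card V : ℝ)

/-! Regularity turns `G` into a cluster graph `R` on clusters of about `l` vertices. `R` keeps the
density: its average degree `d` satisfies `(1 + 5 * δ / 8) * k ≤ d * l`. A vertex-minimal subgraph
of average degree at least `d` then provides a set `A` of clusters with minimum degree at least `h`
and a cluster `x` with at least `2 * h` neighbours in `A`, where `2 * h` clusters have room for the
whole tree and a little more (`exists_dense_clusters`).

The tree is cut into few connected segments, each tiny compared with a cluster
(`exists_segmentedTree`). Apart from its first levels, a segment is to occupy one edge of `R` near
`x`, one colour class at each end. `exists_packing` chooses these edges without overfilling a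
cluster. If the neighbourhood of `x` spans an edge, the resulting triangle makes both parities
available near `x`; a matching of `h` edges in this neighbourhood and its own neighbours then
suffices, as each segment may be oriented so that the two ends of an edge fill evenly. If the
neighbourhood is independent, the larger colour class of the tree goes into its `2 * h` clusters.
The smaller class, at most half of the tree, goes to neighbours of these; they lie outside the
neighbourhood, and `h` choices per cluster are enough.

A segment must start next to the image of its parent. In its first ten levels it walks through the
bipartite double cover of `R`, which keeps the colours right, to its assigned edge
(`exists_assignment`). This is where the degree bound enters: with `N` segments these levels contain
at most `10 * N * Δ ^ 10` vertices, a negligible number. Finally `exists_embedding` realizes the map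
to clusters vertex by vertex. -/

open Finset

/-! ### Segmented trees and greedy embedding into clusters -/

/-- A rooted tree on the vertices `0, …, n - 1`, in which the parent `par i` of a vertex `i > 0`
precedes it and `lev i` is its depth. The tree is cut into connected segments; `seg i` is the first
vertex of the segment of `i`. -/
structure SegmentedTree where
  n : ℕ
  par : ℕ → ℕ
  seg : ℕ → ℕ
  lev : ℕ → ℕ
  par_lt : ∀ i, 0 < i → i < n → par i < i
  lev_par : ∀ i, 0 < i → i < n → lev i = lev (par i) + 1
  seg_le : ∀ i, i < n → seg i ≤ i
  seg_par : ∀ i, i < n → seg i = i ∨ seg (par i) = seg i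

namespace SegmentedTree

/-- The first vertices of the segments. -/
def roots (S : SegmentedTree) : Finset ℕ := {i ∈ range S.n | S.seg i = i}

/-- Greedy embedding of a segmented tree into a graph with disjoint clusters `C c`. The relation `R`
says that all but at most `τ` vertices of the first cluster have at least `κ` neighbours in any given
subset of size at least `θ` of the second one. The vertex `i` goes to the cluster `φ i`, its children
in the same segment to `fwd i`, and its other children to `nxt i`. -/
theorem exists_embedding (S : SegmentedTree) {V ι : Type*} [DecidableEq V] [DecidableEq ι]
    (G : SimpleGraph V) [DecidableRel G.Adj] (C : ι → Finset V)
    (hC : ∀ a b, a ≠ b → Disjoint (C a) (C b)) (R : ι → ι → Prop) (θ κ τ p N : ℕ)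
    (hR : ∀ a b, R a b → ∀ B ⊆ C b, θ ≤ #B → #{v ∈ C a | #{u ∈ B | G.Adj v u} < κ} ≤ τ)
    (hκ : 2 * τ + p + N < κ) (hθ : κ ≤ θ) (φ fwd nxt : ℕ → ι)
    (hfwd : ∀ i, i < S.n → R (φ i) (fwd i)) (hnxt : ∀ i, i < S.n → R (φ i) (nxt i))
    (hroot : ∀ i, 0 < i → i < S.n → S.seg i = i → φ i = nxt (S.par i))
    (hinner : ∀ i, 0 < i → i < S.n → S.seg i ≠ i → φ i = fwd (S.par i))
    (hsize : ∀ c, 2 * θ + #{i ∈ range S.n | φ i = c} ≤ #(C c))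
    (hp : ∀ i, i < S.n → i < S.seg i + p) (hN : #S.roots ≤ N) :
    ∃ f : ℕ → V, Set.InjOn f (Set.Iio S.n) ∧
      ∀ i, 0 < i → i < S.n → G.Adj (f (S.par i)) (f i) := by
  -- `Q c` is reserved for the first vertices of segments, of which there are at most `N` in all.
  -- All other vertices avoid it, so it never fills up.
  have hQ : ∀ c, ∃ Q ⊆ C c, #Q = θ := fun c =>
    exists_subset_card_eq (by have := hsize c; omega)
  choose Q hQC hQ using hQ
  -- The part of the cluster `c` outside `Q c` that was free before vertex `s`. It is used with `s`
  -- the start of the current segment: this set stays frozen during the segment, so a degree into it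
  -- loses at most `p` vertices before it is needed.
  let F : (ℕ → V) → ι → ℕ → Finset V := fun f c s => (C c \ Q c) \ (range s).image f
  have hFC : ∀ f c s, F f c s ⊆ C c := fun f c s => sdiff_subset.trans sdiff_subset
  suffices H : ∀ m, m ≤ S.n → ∃ f : ℕ → V, (∀ i < m, f i ∈ C (φ i)) ∧
      (∀ i < m, ∀ j < i, f j ≠ f i) ∧ (∀ i < m, (f i ∈ Q (φ i) ↔ S.seg i = i)) ∧
      (∀ i < m, 0 < i → G.Adj (f (S.par i)) (f i)) ∧
      (∀ i < m, κ ≤ #{u ∈ Q (nxt i) | G.Adj (f i) u}) ∧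
      (∀ i < m, κ ≤ #{u ∈ F f (fwd i) (S.seg i) | G.Adj (f i) u}) by
    obtain ⟨f, -, h, -, h', -⟩ := H S.n le_rfl
    refine ⟨f, fun i hi j hj hij => ?_, fun i h0 hi => h' i hi h0⟩
    rcases lt_trichotomy i j with hlt | hlt | hlt
    · exact absurd hij (h j hj i hlt)
    · exact hlt
    · exact absurd hij.symm (h i hi j hlt)
  intro m
  induction m with
  | zero =>
    intro _
    obtain hV | ⟨⟨v⟩⟩ := isEmpty_or_nonempty V
    · exfalso
      have := hQ (φ 0)
      rw [Finset.eq_empty_of_isEmpty (Q (φ 0))] at this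
      simp at this
      omega
    · exact ⟨fun _ => v, by simp⟩
  | succ m ih =>
    intro hm
    obtain ⟨f, h1, h2, h3, h4, h5, h6⟩ := ih (by omega)
    have hmn : m < S.n := hm
    have hseg := S.seg_le m hmn
    -- the free part of a cluster is large
    have hF : ∀ c, θ ≤ #(F f c (S.seg m)) := by
      intro c
      have e1 : F f c (S.seg m) = (C c \ Q c) \ ((range (S.seg m)).image f ∩ C c) := by
        ext u; simp only [F, mem_sdiff, mem_inter]; tauto
      have e2 : #((range (S.seg m)).image f ∩ C c) ≤ #{i ∈ range S.n | φ i = c} := by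
        refine (card_le_card (t := ({i ∈ range S.n | φ i = c}).image f) ?_).trans card_image_le
        intro u hu
        simp only [mem_inter, mem_image, mem_range, mem_filter] at hu ⊢
        obtain ⟨⟨i, hi, rfl⟩, hu⟩ := hu
        refine ⟨i, ⟨by omega, ?_⟩, rfl⟩
        by_contra hne
        exact (Finset.disjoint_left.1 (hC _ _ hne) (h1 i (by omega))) hu
      rw [e1]
      have e3 := le_card_sdiff ((range (S.seg m)).image f ∩ C c) (C c \ Q c)
      rw [card_sdiff_of_subset (hQC c), hQ] at e3
      have := hsize c
      omega
    let B : Finset V := if S.seg m = m then Q (φ m) else F f (φ m) (S.seg m)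
    have hBC : B ⊆ C (φ m) := by
      simp only [B]; split_ifs
      · exact hQC _
      · exact hFC _ _ _
    let K : Finset V := if m = 0 then B else {u ∈ B | G.Adj (f (S.par m)) u}
    have hKB : K ⊆ B := by
      simp only [K]; split_ifs
      · exact subset_rfl
      · exact filter_subset _ _
    have hK : κ ≤ #K := by
      simp only [K]
      split_ifs with h0
      · have : S.seg m = m := by omega
        simp only [B, if_pos this, hQ]; exact hθ
      · have hpm := S.par_lt m (by omega) hmn
        by_cases hs : S.seg m = m
        · simp only [B, if_pos hs]
          rw [hroot m (by omega) hmn hs]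
          exact h5 _ hpm
        · simp only [B, if_neg hs]
          rw [hinner m (by omega) hmn hs, ← (S.seg_par m hmn).resolve_left hs]
          exact h6 _ hpm
    -- Used candidates are first vertices of segments if `B` is reserved, and members of the current
    -- segment otherwise. With the `2 * τ` atypical vertices this is still less than `κ`.
    have hU : #((range m).image f ∩ B) ≤ p + N := by
      by_cases hs : S.seg m = m
      · refine (card_le_card (t := S.roots.image f) ?_).trans
          (card_image_le.trans (hN.trans (by omega)))
        intro u hu
        simp only [mem_inter, mem_image, mem_range, B, if_pos hs] at hu
        obtain ⟨⟨i, hi, rfl⟩, hu⟩ := hu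
        have hφ : φ i = φ m := by
          by_contra hne
          exact (Finset.disjoint_left.1 (hC _ _ hne) (h1 i hi)) (hQC _ hu)
        refine mem_image_of_mem _ (mem_filter.2 ⟨mem_range.2 (by omega), (h3 i hi).1 ?_⟩)
        rwa [hφ]
      · refine (card_le_card (t := (Ico (S.seg m) m).image f) ?_).trans
          (card_image_le.trans ?_)
        · intro u hu
          simp only [mem_inter, mem_image, mem_range, B, if_neg hs, F, mem_sdiff] at hu
          obtain ⟨⟨i, hi, rfl⟩, -, hu⟩ := hu
          refine mem_image_of_mem _ (mem_Ico.2 ⟨?_, hi⟩)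
          by_contra hlt
          exact hu ⟨i, by omega, rfl⟩
        · have := hp m hmn
          rw [Nat.card_Ico]; omega
    have hb1 := hR _ _ (hnxt m hmn) (Q (nxt m)) (hQC _) (hQ _).ge
    have hb2 := hR _ _ (hfwd m hmn) (F f (fwd m) (S.seg m)) (hFC _ _ _) (hF _)
    set b1 := {v ∈ C (φ m) | #{u ∈ Q (nxt m) | G.Adj v u} < κ} with hb1d
    set b2 := {v ∈ C (φ m) | #{u ∈ F f (fwd m) (S.seg m) | G.Adj v u} < κ} with hb2d
    obtain ⟨v, hv⟩ : (K \ (((range m).image f ∩ B) ∪ (b1 ∪ b2))).Nonempty := by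
      rw [← card_pos]
      have e1 := le_card_sdiff (((range m).image f ∩ B) ∪ (b1 ∪ b2)) K
      have e2 := card_union_le ((range m).image f ∩ B) (b1 ∪ b2)
      have e3 := card_union_le b1 b2
      omega
    simp only [mem_sdiff, mem_union, not_or] at hv
    obtain ⟨hvK, hvU, hv1, hv2⟩ := hv
    have hvB := hKB hvK
    have hvC := hBC hvB
    have hvU' : ∀ j < m, f j ≠ v := fun j hj h =>
      hvU (mem_inter.2 ⟨mem_image.2 ⟨j, mem_range.2 hj, h⟩, hvB⟩)
    -- `F f c s` only looks at values of `f` below `s`, so the earlier degree conditions survive the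
    -- extension.
    have hFu : ∀ c s, s ≤ m → F (Function.update f m v) c s = F f c s := by
      intro c s hs
      simp only [F]
      congr 1
      refine image_congr fun i hi => ?_
      have : i < s := by simpa using hi
      exact Function.update_of_ne (by omega) _ _
    have hne : ∀ i, i < m → Function.update f m v i = f i := fun i hi =>
      Function.update_of_ne (by omega) _ _
    have heq : Function.update f m v m = v := Function.update_self _ _ _
    refine ⟨Function.update f m v, ?_, ?_, ?_, ?_, ?_, ?_⟩ <;> intro i hi <;>
      rcases Nat.lt_succ_iff_lt_or_eq.1 hi with hi' | rfl
    · rw [hne i hi']; exact h1 i hi'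
    · rw [heq]; exact hvC
    · intro j hj
      rw [hne i hi', hne j (by omega)]; exact h2 i hi' j hj
    · intro j hj
      rw [heq, hne j hj]; exact hvU' j hj
    · rw [hne i hi']; exact h3 i hi'
    · rw [heq]
      by_cases hs : S.seg i = i
      · simp only [B, if_pos hs] at hvB
        simp [hvB, hs]
      · simp only [B, if_neg hs, F, mem_sdiff] at hvB
        simp [hvB.1.2, hs]
    · intro h0
      have := S.par_lt i h0 (by omega)
      rw [hne i hi', hne _ (by omega)]; exact h4 i hi' h0
    · intro h0
      have := S.par_lt i h0 (by omega)
      rw [heq, hne _ this]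
      simp only [K, if_neg h0.ne'] at hvK
      exact (mem_filter.1 hvK).2
    · rw [hne i hi']; exact h5 i hi'
    · rw [heq]
      by_contra hlt
      exact hv1 (mem_filter.2 ⟨hvC, not_le.1 hlt⟩)
    · rw [hne i hi', hFu _ _ ((S.seg_le i (by omega)).trans hi'.le)]; exact h6 i hi'
    · rw [heq, hFu _ _ hseg]
      by_contra hlt
      exact hv2 (mem_filter.2 ⟨hvC, not_le.1 hlt⟩)

end SegmentedTree

/-! ### Cutting a rooted tree into segments -/

/-- Every finset can be enumerated such that a given rank is non-decreasing. -/
theorem Finset.exists_enumeration {W : Type*} [DecidableEq W] [Nonempty W] (dep : W → ℕ)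
    (P : Finset W) :
    ∃ g : ℕ → W, (∀ i < #P, g i ∈ P) ∧ (∀ i < #P, ∀ j < #P, g i = g j → i = j) ∧
      (∀ u ∈ P, ∃ i < #P, g i = u) ∧ ∀ i < #P, ∀ j < #P, dep (g i) < dep (g j) → i < j := by
  induction P using Finset.induction_on_max_value dep with
  | empty =>
    exact ⟨fun _ => Classical.arbitrary W, by simp⟩
  | insert a s ha hs ih =>
    obtain ⟨g, h1, h2, h3, h4⟩ := ih
    rw [card_insert_of_notMem ha]
    have hga : ∀ i < #s, g i ≠ a := fun i hi h => ha (h ▸ h1 i hi)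
    have key : ∀ i < #s + 1, (i < #s ∧ (if i = #s then a else g i) = g i) ∨
        (i = #s ∧ (if i = #s then a else g i) = a) := by
      intro i hi
      by_cases h : i = #s
      · right; simp [h]
      · left; exact ⟨by omega, by simp [h]⟩
    refine ⟨fun i => if i = #s then a else g i, ?_, ?_, ?_, ?_⟩
    · intro i hi
      rcases key i hi with ⟨h, e⟩ | ⟨h, e⟩ <;> simp only [e]
      · exact mem_insert_of_mem (h1 i h)
      · exact mem_insert_self _ _
    · intro i hi j hj hij
      rcases key i hi with ⟨h, e⟩ | ⟨h, e⟩ <;> rcases key j hj with ⟨h', e'⟩ | ⟨h', e'⟩ <;>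
        simp only [e, e'] at hij
      · exact h2 i h j h' hij
      · exact absurd hij (hga i h)
      · exact absurd hij.symm (hga j h')
      · omega
    · intro u hu
      rcases mem_insert.1 hu with rfl | hu
      · exact ⟨#s, by omega, by simp⟩
      · obtain ⟨i, hi, rfl⟩ := h3 u hu
        exact ⟨i, by omega, by simp [hi.ne]⟩
    · intro i hi j hj hij
      rcases key i hi with ⟨h, e⟩ | ⟨h, e⟩ <;> rcases key j hj with ⟨h', e'⟩ | ⟨h', e'⟩ <;>
        simp only [e, e'] at hij
      · exact h4 i h j h' hij
      · omega
      · exact absurd (hs _ (h1 j h')) (by omega)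
      · omega

section RootedTree

variable {W : Type*} (par : W → W) (dep : W → ℕ) (r : W)

/-- Passing to the parent lowers `dep` except at the fixed point `r`. Hence a vertex is the unique
one of least depth among its descendants, and comes first when these are enumerated by depth. -/
theorem iterate_parent_eq_or_lt (hr : par r = r) (hdep : ∀ v, v ≠ r → dep v = dep (par v) + 1)
    (v : W) : ∀ (j : ℕ) (u : W), par^[j] u = v → u = v ∨ dep v < dep u := by
  intro j
  induction j with
  | zero => intro u h; exact Or.inl h
  | succ j ih =>
    intro u h
    rw [Function.iterate_succ_apply] at h
    by_cases hu : u = r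
    · subst hu; rw [hr] at h; exact ih _ h
    · right
      have := hdep u hu
      rcases ih _ h with h | h
      · rw [h] at this; omega
      · omega

theorem exists_iterate_parent_eq_root (hdep : ∀ v, v ≠ r → dep v = dep (par v) + 1) (u : W) :
    ∃ j, par^[j] u = r := by
  induction h : dep u generalizing u with
  | zero =>
    refine ⟨0, ?_⟩
    by_contra hu
    have := hdep u hu
    omega
  | succ d ih =>
    by_cases hu : u = r
    · exact ⟨0, hu⟩
    · have := hdep u hu
      obtain ⟨j, hj⟩ := ih (par u) (by omega)
      exact ⟨j + 1, by rwa [Function.iterate_succ_apply]⟩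

/-- A rooted tree with at most `Δ` children per vertex has an enumeration which cuts it into
connected segments with at most `Δ * q + 1` vertices, and at least `q` on average. -/
theorem exists_segmentation [Fintype W] [DecidableEq W] (hr : par r = r)
    (hdep : ∀ v, v ≠ r → dep v = dep (par v) + 1) (Δ q : ℕ) (hq : 0 < q)
    (hΔ : ∀ v, #{u | u ≠ r ∧ par u = v} ≤ Δ) (A : Finset W) (hA : ∀ u ∈ A, par u ∈ A) :
    ∃ (e : ℕ → W) (seg : ℕ → ℕ), (∀ i < #A, e i ∈ A) ∧
      (∀ i < #A, ∀ j < #A, e i = e j → i = j) ∧ (∀ u ∈ A, ∃ i < #A, e i = u) ∧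
      (∀ i < #A, e i ≠ r → ∃ j < i, e j = par (e i) ∧ (seg i = i ∨ seg j = seg i)) ∧
      (∀ i < #A, seg i ≤ i ∧ i < seg i + (Δ * q + 1)) ∧
      #{i ∈ range #A | seg i = i} * q ≤ #A + q := by
  classical
  induction hn : #A using Nat.strong_induction_on generalizing A with
  | _ n ih =>
  subst hn
  rcases A.eq_empty_or_nonempty with rfl | ⟨u₀, hu₀⟩
  · exact ⟨fun _ => r, id, by simp⟩
  have hiter : ∀ j, ∀ u ∈ A, par^[j] u ∈ A := by
    intro j
    induction j with
    | zero => intro u hu; exact hu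
    | succ j ihj => intro u hu; rw [Function.iterate_succ_apply]; exact ihj _ (hA u hu)
  have hrA : r ∈ A := by
    obtain ⟨j, hj⟩ := exists_iterate_parent_eq_root par dep r hdep u₀
    exact hj ▸ hiter j u₀ hu₀
  let desc : W → Finset W := fun v => {u ∈ A | ∃ j, par^[j] u = v}
  -- Take a deepest `v` with at least `q` descendants in `A`, or the root if there is no other. Each
  -- child of `v` then has at most `q` descendants, so those of `v` form a segment of at most `Δ * q
  -- + 1` vertices. It is placed at the end of the enumeration, and the rest is still closed under
  -- parents.
  obtain ⟨v, hv, hmax⟩ := exists_max_image {v ∈ A | v = r ∨ q ≤ #(desc v)} dep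
    ⟨r, by simp [hrA]⟩
  obtain ⟨hvA, hvq⟩ := mem_filter.1 hv
  have hlt := iterate_parent_eq_or_lt par dep r hr hdep
  set P := desc v with hP
  have hvP : v ∈ P := mem_filter.2 ⟨hvA, 0, rfl⟩
  have hPA : P ⊆ A := filter_subset _ _
  have hchild : ∀ c ∈ ({u | u ≠ r ∧ par u = v} : Finset W), #(desc c) ≤ q := by
    intro c hc
    obtain ⟨hcr, hcv⟩ := (mem_filter.1 hc).2
    by_contra! hcq
    obtain ⟨u, hu⟩ : (desc c).Nonempty := card_pos.1 (by omega)
    obtain ⟨huA, j, rfl⟩ := mem_filter.1 hu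
    have h1 := hmax _ (mem_filter.2 ⟨hiter j u huA, Or.inr hcq.le⟩)
    have h2 := hdep _ hcr
    rw [hcv] at h2
    omega
  have hPcard : #P ≤ Δ * q + 1 := by
    have hsub : P ⊆ insert v (({u | u ≠ r ∧ par u = v} : Finset W).biUnion desc) := by
      intro u hu
      obtain ⟨huA, hj⟩ := mem_filter.1 hu
      have hspec := Nat.find_spec hj
      have hmin := fun i => Nat.find_min (m := i) hj
      rcases hf : Nat.find hj with _ | j
      · rw [hf] at hspec
        exact mem_insert.2 (Or.inl hspec)
      · rw [hf] at hspec hmin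
        rw [Function.iterate_succ_apply'] at hspec
        refine mem_insert_of_mem (mem_biUnion.2 ⟨par^[j] u, mem_filter.2 ⟨mem_univ _, ?_, hspec⟩,
          mem_filter.2 ⟨huA, j, rfl⟩⟩)
        intro hcr
        rw [hcr, hr] at hspec
        exact hmin j (by omega) (hcr.trans hspec)
    calc #P ≤ _ := card_le_card hsub
      _ ≤ #(({u | u ≠ r ∧ par u = v} : Finset W).biUnion desc) + 1 := card_insert_le _ _
      _ ≤ #({u | u ≠ r ∧ par u = v} : Finset W) * q + 1 := by
        gcongr; exact card_biUnion_le_card_mul _ _ _ hchild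
      _ ≤ Δ * q + 1 := by gcongr; exact hΔ v
  have hA' : ∀ u ∈ A \ P, par u ∈ A \ P := by
    intro u hu
    obtain ⟨huA, huP⟩ := mem_sdiff.1 hu
    refine mem_sdiff.2 ⟨hA u huA, fun h => huP ?_⟩
    obtain ⟨-, j, hj⟩ := mem_filter.1 h
    exact mem_filter.2 ⟨huA, j + 1, by rwa [Function.iterate_succ_apply]⟩
  have hcard : #(A \ P) + #P = #A := card_sdiff_add_card_eq_card hPA
  have hPpos : 0 < #P := card_pos.2 ⟨v, hvP⟩
  obtain ⟨e, seg, he1, he2, he3, he4, he5, he6⟩ := ih #(A \ P) (by omega) (A \ P) hA' rfl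
  have : Nonempty W := ⟨r⟩
  obtain ⟨g, hg1, hg2, hg3, hg4⟩ := P.exists_enumeration dep
  set a := #(A \ P) with ha
  have key : ∀ i < #A, (i < a ∧ (if i < a then e i else g (i - a)) = e i ∧
      (if i < a then seg i else a) = seg i) ∨ (a ≤ i ∧ i - a < #P ∧
      (if i < a then e i else g (i - a)) = g (i - a) ∧ (if i < a then seg i else a) = a) := by
    intro i hi
    by_cases h : i < a
    · left; simp [h]
    · right; simp only [if_neg h, and_true]; omega
  refine ⟨fun i => if i < a then e i else g (i - a), fun i => if i < a then seg i else a,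
    ?_, ?_, ?_, ?_, ?_, ?_⟩
  · intro i hi
    rcases key i hi with ⟨h, h1, -⟩ | ⟨-, h, h1, -⟩ <;> simp only [h1]
    · exact sdiff_subset (he1 i h)
    · exact hPA (hg1 _ h)
  · intro i hi j hj hij
    rcases key i hi with ⟨h, h1, -⟩ | ⟨h0, h, h1, -⟩ <;>
      rcases key j hj with ⟨h', h1', -⟩ | ⟨h0', h', h1', -⟩ <;> simp only [h1, h1'] at hij
    · exact he2 i h j h' hij
    · exact absurd (hij ▸ hg1 _ h') (mem_sdiff.1 (he1 i h)).2
    · exact absurd (hij ▸ hg1 _ h) (mem_sdiff.1 (he1 j h')).2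
    · have := hg2 _ h _ h' hij
      omega
  · intro u hu
    by_cases huP : u ∈ P
    · obtain ⟨i, hi, rfl⟩ := hg3 u huP
      exact ⟨a + i, by omega, by simp⟩
    · obtain ⟨i, hi, rfl⟩ := he3 u (mem_sdiff.2 ⟨hu, huP⟩)
      exact ⟨i, by omega, by simp [hi]⟩
  · intro i hi hir
    rcases key i hi with ⟨h, h1, h2⟩ | ⟨h0, h, h1, h2⟩ <;> simp only [h1, h2] at hir ⊢
    · obtain ⟨j, hj, h3, h4⟩ := he4 i h hir
      refine ⟨j, hj, ?_⟩
      rw [if_pos (by omega), if_pos (by omega)]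
      exact ⟨h3, h4⟩
    · by_cases hgv : g (i - a) = v
      · have hpv : par v ∈ A \ P := by
          refine mem_sdiff.2 ⟨hA v hvA, fun hp => ?_⟩
          obtain ⟨-, j, hj⟩ := mem_filter.1 hp
          have h3 := hdep v (hgv ▸ hir)
          rcases hlt v j _ hj with h4 | h4
          · rw [h4] at h3; omega
          · omega
        obtain ⟨j, hj, hje⟩ := he3 _ hpv
        refine ⟨j, by omega, ?_⟩
        rw [if_pos hj, hgv]
        refine ⟨hje, Or.inl ?_⟩
        by_contra hne
        obtain ⟨-, j', hj'⟩ := mem_filter.1 (hg1 0 hPpos)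
        rcases hlt v j' _ hj' with h4 | h4
        · have := hg2 0 hPpos _ h (h4.trans hgv.symm)
          omega
        · rw [← hgv] at h4
          have := hg4 _ h _ hPpos h4
          omega
      · have hpP : par (g (i - a)) ∈ P := by
          obtain ⟨hgA, j, hj⟩ := mem_filter.1 (hg1 _ h)
          rcases j with _ | j
          · exact absurd hj hgv
          · exact mem_filter.2 ⟨hA _ hgA, j, by rwa [Function.iterate_succ_apply] at hj⟩
        obtain ⟨j, hj, hje⟩ := hg3 _ hpP
        have h3 := hdep _ hir
        rw [← hje] at h3
        have h4 := hg4 j hj _ h (by omega)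
        refine ⟨a + j, by omega, ?_⟩
        simp [hje]
  · intro i hi
    rcases key i hi with ⟨h, -, h2⟩ | ⟨h0, h, -, h2⟩ <;> simp only [h2]
    · exact he5 i h
    · omega
  · have hsub : ({i ∈ range #A | (if i < a then seg i else a) = i} : Finset ℕ) ⊆
        insert a {i ∈ range a | seg i = i} := by
      intro i hi
      obtain ⟨hi, hs⟩ := mem_filter.1 hi
      rcases key i (mem_range.1 hi) with ⟨h, -, h2⟩ | ⟨h0, h, -, h2⟩ <;> rw [h2] at hs
      · exact mem_insert_of_mem (mem_filter.2 ⟨mem_range.2 h, hs⟩)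
      · exact mem_insert.2 (Or.inl hs.symm)
    have hle := (card_le_card hsub).trans (card_insert_le _ _)
    refine (Nat.mul_le_mul_right q hle).trans ?_
    -- Only a segment cut at the root may have fewer than `q` vertices, and it exhausts `A`; the
    -- extra `q` in the bound pays for it.
    rcases hvq with hvr | hvq
    · have : A \ P = ∅ := by
        rw [sdiff_eq_empty_iff_subset]
        intro u hu
        obtain ⟨j, hj⟩ := exists_iterate_parent_eq_root par dep r hdep u
        exact mem_filter.2 ⟨hu, j, hj.trans hvr.symm⟩
      have ha0 : a = 0 := by rw [ha, this, card_empty]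
      simp [ha0]
    · rw [add_mul]
      omega

end RootedTree

/-- A finite tree is isomorphic to a segmented tree with segments of bounded size. -/
theorem SimpleGraph.IsTree.exists_segmentedTree {W : Type*} [Fintype W] {T : SimpleGraph W}
    [DecidableRel T.Adj] (hT : T.IsTree) (q : ℕ) (hq : 0 < q) :
    ∃ (S : SegmentedTree) (num : W → ℕ), S.n = Fintype.card W ∧ Function.Injective num ∧
      (∀ w, num w < S.n) ∧ (∀ u v, T.Adj u v → (0 < num u ∧ S.par (num u) = num v) ∨
        (0 < num v ∧ S.par (num v) = num u)) ∧
      (∀ j, #{i ∈ range S.n | 0 < i ∧ S.par i = j} ≤ T.maxDegree) ∧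
      (∀ i, i < S.n → i < S.seg i + (T.maxDegree * q + 1)) ∧ #S.roots * q ≤ S.n + q := by
  classical
  obtain ⟨r⟩ := hT.connected.nonempty
  have hstep : ∀ v, ∃ u, v ≠ r → T.Adj v u ∧ T.dist v r = T.dist u r + 1 := by
    intro v
    by_cases hv : v = r
    · exact ⟨v, fun h => absurd hv h⟩
    obtain ⟨p, hp⟩ := (hT.connected v r).exists_walk_length_eq_dist
    cases p with
    | nil => exact absurd rfl hv
    | @cons _ u _ h p =>
      refine ⟨u, fun _ => ⟨h, ?_⟩⟩
      have h1 := SimpleGraph.dist_le p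
      have h2 := hT.dist_eq_dist_add_one_of_adj r h
      rw [SimpleGraph.dist_comm, SimpleGraph.dist_comm (u := r) (v := u)] at h2
      rw [SimpleGraph.Walk.length_cons] at hp
      omega
  choose par₀ hpar₀ using hstep
  let par : W → W := fun v => if v = r then r else par₀ v
  have hr : par r = r := if_pos rfl
  have hpar : ∀ v, v ≠ r → T.Adj v (par v) ∧ T.dist v r = T.dist (par v) r + 1 := by
    intro v hv
    simp only [par, if_neg hv]
    exact hpar₀ v hv
  -- The edges from non-root vertices to their parents are distinct, and there are as many of them
  -- as edges of the tree.
  have hedge : ∀ u v, T.Adj u v → (u ≠ r ∧ par u = v) ∨ (v ≠ r ∧ par v = u) := by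
    have hsub : (univ.erase r).image (fun v => s(v, par v)) ⊆ T.edgeFinset := by
      intro x hx
      obtain ⟨v, hv, rfl⟩ := mem_image.1 hx
      rw [SimpleGraph.mem_edgeFinset, SimpleGraph.mem_edgeSet]
      exact (hpar v (ne_of_mem_erase hv)).1
    have heq := eq_of_subset_of_card_le hsub (by
      rw [card_image_of_injOn]
      · have := hT.card_edgeFinset
        rw [card_erase_of_mem (mem_univ _), card_univ]
        omega
      · intro u hu v hv huv
        have hu' := hpar u (ne_of_mem_erase hu)
        have hv' := hpar v (ne_of_mem_erase hv)
        simp only [Sym2.eq_iff] at huv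
        rcases huv with h | ⟨h, h'⟩
        · exact h.1
        · rw [← h] at hv'
          rw [h'] at hu'
          omega)
    intro u v huv
    have : s(u, v) ∈ T.edgeFinset := by rwa [SimpleGraph.mem_edgeFinset, SimpleGraph.mem_edgeSet]
    rw [← heq] at this
    obtain ⟨w, hw, hwe⟩ := mem_image.1 this
    simp only [Sym2.eq_iff] at hwe
    rcases hwe with ⟨rfl, h⟩ | ⟨rfl, h⟩
    · exact Or.inl ⟨ne_of_mem_erase hw, h⟩
    · exact Or.inr ⟨ne_of_mem_erase hw, h⟩
  have hΔ : ∀ v, #{u | u ≠ r ∧ par u = v} ≤ T.maxDegree := by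
    intro v
    refine le_trans (card_le_card ?_) (T.degree_le_maxDegree v)
    intro u hu
    obtain ⟨-, hur, rfl⟩ := mem_filter.1 hu
    rw [SimpleGraph.mem_neighborFinset]
    exact (hpar u hur).1.symm
  obtain ⟨e, seg, h1, h2, h3, h4, h5, h6⟩ := exists_segmentation par (fun v => T.dist v r) r hr
    (fun v hv => (hpar v hv).2) T.maxDegree q hq hΔ univ (fun _ _ => mem_univ _)
  rw [card_univ] at *
  set n := Fintype.card W
  choose num hnum hnume using fun u => h3 u (mem_univ u)
  have hinj : Function.Injective num := fun u v h => by rw [← hnume u, ← hnume v, h]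
  have hnum_e : ∀ i < n, num (e i) = i := fun i hi => h2 _ (hnum _) _ hi (hnume _)
  have h0 : ∀ i < n, 0 < i → e i ≠ r := by
    intro i hi hi0 hir
    by_cases h : e 0 = r
    · exact absurd (h2 _ hi 0 (by omega) (hir.trans h.symm)) (by omega)
    · obtain ⟨j, hj, -⟩ := h4 0 (by omega) h
      omega
  have hpar_num : ∀ i < n, 0 < i → num (par (e i)) < i ∧
      (seg i = i ∨ seg (num (par (e i))) = seg i) := by
    intro i hi hi0
    obtain ⟨j, hj, hje, hs⟩ := h4 i hi (h0 i hi hi0)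
    rw [← hje, hnum_e j (by omega)]
    exact ⟨hj, hs⟩
  refine ⟨⟨n, fun i => num (par (e i)), seg, fun i => T.dist (e i) r, ?_, ?_, ?_, ?_⟩, num, rfl,
    hinj, hnum, ?_, ?_, ?_, h6⟩
  · exact fun i hi0 hi => (hpar_num i hi hi0).1
  · intro i hi0 hi
    rw [hnume]
    exact (hpar _ (h0 i hi hi0)).2
  · exact fun i hi => (h5 i hi).1
  · intro i hi
    rcases Nat.eq_zero_or_pos i with rfl | hi0
    · left; have := (h5 0 hi).1; omega
    · exact (hpar_num i hi hi0).2
  · have hpos : ∀ u, u ≠ r → 0 < num u := by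
      intro u hu
      by_contra h
      have h7 : num u = 0 := by omega
      have h8 : e 0 = u := by rw [← h7, hnume]
      obtain ⟨j, hj, -⟩ := h4 0 (h7 ▸ hnum u) (by rwa [h8])
      omega
    intro u v huv
    rcases hedge u v huv with ⟨h, h'⟩ | ⟨h, h'⟩
    · exact Or.inl ⟨hpos u h, by simp only [hnume, h']⟩
    · exact Or.inr ⟨hpos v h, by simp only [hnume, h']⟩
  · intro j
    by_cases hj : j < n
    · refine le_trans ?_ (hΔ (e j))
      refine card_le_card_of_injOn e ?_ ?_
      · intro i hi
        obtain ⟨hi, hi0, hij⟩ := mem_filter.1 (mem_coe.1 hi)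
        simp only [mem_range] at hi
        refine mem_coe.2 (mem_filter.2 ⟨mem_univ _, h0 i hi hi0, ?_⟩)
        rw [← hij, hnume]
      · intro i hi i' hi' h
        simp only [coe_filter, mem_range, Set.mem_ofPred_eq] at hi hi'
        exact h2 i hi.1 i' hi'.1 h
    · have : ({i ∈ range n | 0 < i ∧ num (par (e i)) = j} : Finset ℕ) = ∅ := by
        rw [filter_eq_empty_iff]
        rintro i - ⟨-, h⟩
        exact hj (h ▸ hnum _)
      simp only [this, card_empty, zero_le]
  · exact fun i hi => (h5 i hi).2

/-! ### Walks near a fixed vertex -/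

namespace SimpleGraph

variable {κ : Type*} {D : SimpleGraph κ}

/-- The vertices at distance at most `r` from `x`. -/
def Near (D : SimpleGraph κ) (x : κ) (r : ℕ) (c : κ) : Prop := ∃ p : D.Walk c x, p.length ≤ r

theorem Near.step {x a b : κ} {r : ℕ} (h : D.Near x r b) (hab : D.Adj a b) :
    D.Near x (r + 1) a := by
  obtain ⟨p, hp⟩ := h
  exact ⟨p.cons hab, by simpa using hp⟩

theorem Near.mono {x a : κ} {r r' : ℕ} (h : D.Near x r a) (hr : r ≤ r') : D.Near x r' a :=
  let ⟨p, hp⟩ := h; ⟨p, hp.trans hr⟩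

theorem near_self (D : SimpleGraph κ) (x : κ) (r : ℕ) : D.Near x r x := ⟨Walk.nil, by simp⟩

/-- `w` is an infinite walk near `x`, which from time `m` on uses only `y` and `z`. -/
structure IsRoute (D : SimpleGraph κ) (x : κ) (r : ℕ) (y z : κ) (m : ℕ) (w : ℕ → κ) : Prop where
  adj : ∀ t, D.Adj (w t) (w (t + 1))
  near : ∀ t, D.Near x r (w t)
  eq_or_eq : ∀ t, m ≤ t → w t = y ∨ w t = z

theorem exists_isRoute_of_walk {x y z : κ} {r : ℕ} {a b : κ} (p : D.Walk a b)
    (hp : ∀ u ∈ p.support, D.Near x r u) {m : ℕ}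
    (hw : ∃ w, w 0 = b ∧ D.IsRoute x r y z m w) :
    ∃ w, w 0 = a ∧ D.IsRoute x r y z (m + p.length) w := by
  induction p with
  | nil => exact hw
  | @cons a c b h p ih =>
    obtain ⟨w, h0, h1⟩ := ih (fun u hu => hp u (by simp [hu])) hw
    refine ⟨fun t => Nat.casesOn t a w, rfl, ⟨?_, ?_, ?_⟩⟩
    · rintro (_ | t)
      · simpa [h0] using h
      · exact h1.adj t
    · rintro (_ | t)
      · exact hp a (by simp)
      · exact h1.near t
    · rintro (_ | t) ht
      · simp at ht
      · exact h1.eq_or_eq t (by simp at ht; omega)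

/-- Walk from `c` to `x` and on to `y`, at most `r` steps each, then alternate between `y` and `z`
forever. Every vertex on a walk of length at most `r` to `x` is itself near `x`. -/
theorem exists_isRoute {x y z c : κ} {r : ℕ} (hc : D.Near x r c) (hyz : D.Adj y z)
    (hy : D.Near x r y) (hz : D.Near x r z) :
    ∃ w, w 0 = c ∧ D.IsRoute x r y z (2 * r) w := by
  classical
  obtain ⟨p, hp⟩ := hc
  obtain ⟨q, hq⟩ := hy
  have hsupp : ∀ {a : κ} (p : D.Walk a x), p.length ≤ r → ∀ u ∈ p.support, D.Near x r u :=
    fun p hp u hu => ⟨p.dropUntil u hu, (p.length_dropUntil_le_length hu).trans hp⟩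
  have halt : ∃ w, w 0 = y ∧ D.IsRoute x r y z 0 w := by
    refine ⟨fun t => if t % 2 = 0 then y else z, rfl, ⟨fun t => ?_, fun t => ?_, fun t _ => ?_⟩⟩
    · rcases Nat.mod_two_eq_zero_or_one t with h | h
      · have h' : (t + 1) % 2 = 1 := by omega
        simpa [h, h'] using hyz
      · have h' : (t + 1) % 2 = 0 := by omega
        simpa [h, h'] using hyz.symm
    · split_ifs
      exacts [⟨q, hq⟩, hz]
    · split_ifs <;> simp
  have h1 := exists_isRoute_of_walk q.reverse (fun u hu => hsupp q hq u (by simpa using hu)) halt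
  obtain ⟨w, h0, h2⟩ := exists_isRoute_of_walk p (hsupp p hp) h1
  refine ⟨w, h0, h2.adj, h2.near, fun t ht => h2.eq_or_eq t ?_⟩
  simp only [Walk.length_reverse]
  omega

end SimpleGraph

/-! ### Mapping a segmented tree to the cluster level -/

namespace SegmentedTree

variable (S : SegmentedTree)

theorem seg_seg : ∀ i, i < S.n → S.seg (S.seg i) = S.seg i := by
  intro i
  induction i using Nat.strong_induction_on with
  | _ i ih =>
    intro hi
    rcases S.seg_par i hi with h | h
    · rw [h, h]
    · rcases Nat.eq_zero_or_pos i with rfl | h0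
      · have := S.seg_le 0 hi
        have h' : S.seg 0 = 0 := by omega
        rw [h', h']
      · have := S.par_lt i h0 hi
        rw [← h, ih _ this (by omega)]

theorem lev_seg_le : ∀ i, i < S.n → S.lev (S.seg i) ≤ S.lev i := by
  intro i
  induction i using Nat.strong_induction_on with
  | _ i ih =>
    intro hi
    by_cases hs : S.seg i = i
    · rw [hs]
    · have h0 : 0 < i := by have := S.seg_le i hi; omega
      have := S.par_lt i h0 hi
      rw [← (S.seg_par i hi).resolve_left hs, S.lev_par i h0 hi]
      exact (ih _ this (by omega)).trans (by omega)

/-- Follow in the segment starting at `s` the walk `w c s`, where `c` is the image of the parent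
of `s`. -/
noncomputable def assign {κ : Type*} (w : κ → ℕ → ℕ → κ) (c : κ) (i : ℕ) : κ :=
  -- The second condition holds for every vertex of the tree with `0 < S.seg i`; it is there for
  -- termination.
  if _h : 0 < S.seg i ∧ S.par (S.seg i) < i then
    w (assign w c (S.par (S.seg i))) (S.seg i) (S.lev i - S.lev (S.seg i))
  else w c (S.seg i) (S.lev i - S.lev (S.seg i))
termination_by i
decreasing_by exact _h.2

/-- A segmented tree can be mapped to a graph `D` such that in each segment `s`, all but the first
few levels are mapped to the edge `y s, z s`. -/
theorem exists_assignment {κ : Type*} (D : SimpleGraph κ) (col : κ → Bool)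
    (hcol : ∀ a b, D.Adj a b → col a ≠ col b) (x : κ) (r : ℕ) (hr : 1 ≤ r) (hx : ∃ a, D.Adj x a)
    (y z : ℕ → κ) (hyz : ∀ s, D.Adj (y s) (z s)) (hy : ∀ s, D.Near x r (y s))
    (hz : ∀ s, D.Near x r (z s)) (tc : ℕ → Bool)
    (htc : ∀ i, 0 < i → i < S.n → tc i ≠ tc (S.par i)) :
    ∃ φ fwd nxt : ℕ → κ, (∀ i, i < S.n → D.Adj (φ i) (fwd i)) ∧
      (∀ i, i < S.n → D.Adj (φ i) (nxt i)) ∧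
      (∀ i, 0 < i → i < S.n → S.seg i = i → φ i = nxt (S.par i)) ∧
      (∀ i, 0 < i → i < S.n → S.seg i ≠ i → φ i = fwd (S.par i)) ∧
      (∀ i, i < S.n → col (φ i) = tc i) ∧
      ∀ i, i < S.n → S.lev (S.seg i) + 2 * r ≤ S.lev i → φ i = y (S.seg i) ∨ φ i = z (S.seg i) := by
  obtain ⟨a, hxa⟩ := hx
  have hnx : ∀ c, ∃ b, D.Near x r c → D.Adj c b ∧ D.Near x r b := by
    intro c
    by_cases hc : D.Near x r c
    · obtain ⟨p, hp⟩ := hc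
      cases p with
      | nil => exact ⟨a, fun _ => ⟨hxa, ((D.near_self x 0).step hxa.symm).mono hr⟩⟩
      | @cons _ b _ h p =>
        exact ⟨b, fun _ => ⟨h, p, by rw [SimpleGraph.Walk.length_cons] at hp; omega⟩⟩
    · exact ⟨c, fun h => absurd h hc⟩
  choose nx hnx using hnx
  have hw : ∀ c s, ∃ w, D.Near x r c → w 0 = nx c ∧ D.IsRoute x r (y s) (z s) (2 * r) w := by
    intro c s
    by_cases hc : D.Near x r c
    · obtain ⟨w, hw⟩ := SimpleGraph.exists_isRoute (hnx c hc).2 (hyz s) (hy s) (hz s)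
      exact ⟨w, fun _ => hw⟩
    · exact ⟨fun _ => c, fun h => absurd h hc⟩
  choose w hw using hw
  -- The colour of the tree root is prescribed. The adjacent vertices `x` and `a` have different
  -- colours, so `nx x` and `nx a` do too, and one of them fits.
  have hstart : ∃ c, D.Near x r c ∧ col (nx c) = tc 0 := by
    by_cases h : col (nx x) = tc 0
    · exact ⟨x, D.near_self x r, h⟩
    · have ha : D.Near x r a := ((D.near_self x 0).step hxa.symm).mono hr
      refine ⟨a, ha, ?_⟩
      have h1 := hcol _ _ hxa
      have h2 := hcol _ _ (hnx a ha).1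
      have h3 := hcol _ _ (hnx x (D.near_self x r)).1
      revert h h1 h2 h3
      cases col (nx x) <;> cases tc 0 <;> cases col x <;> cases col a <;> cases col (nx a) <;> simp
  obtain ⟨c, hc, hcc⟩ := hstart
  let φ := S.assign w c
  -- For the segment of the root, `c` replaces the image of the missing parent.
  let base : ℕ → κ := fun s => if 0 < s then φ (S.par s) else c
  have hφ : ∀ i, i < S.n → φ i = w (base (S.seg i)) (S.seg i) (S.lev i - S.lev (S.seg i)) := by
    intro i hi
    simp only [φ, base]
    rw [assign]
    have := S.seg_le i hi
    by_cases h : 0 < S.seg i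
    · have := S.par_lt _ h (by omega)
      rw [dif_pos ⟨h, by omega⟩, if_pos h]
    · rw [dif_neg (fun h' => h h'.1), if_neg h]
  have hnear : ∀ i, i < S.n → D.Near x r (base (S.seg i)) ∧ D.Near x r (φ i) := by
    intro i
    induction i using Nat.strong_induction_on with
    | _ i ih =>
      intro hi
      have hb : D.Near x r (base (S.seg i)) := by
        simp only [base]
        split_ifs with h
        · have := S.seg_le i hi
          have := S.par_lt _ h (by omega)
          exact (ih _ (by omega) (by omega)).2
        · exact hc
      refine ⟨hb, ?_⟩
      rw [hφ i hi]
      exact (hw _ _ hb).2.near _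
  have hroot : ∀ i, 0 < i → i < S.n → S.seg i = i → φ i = nx (φ (S.par i)) := by
    intro i h0 hi hs
    have hb := (hnear i hi).1
    rw [hφ i hi]
    rw [hs] at hb ⊢
    rw [Nat.sub_self, (hw _ _ hb).1]
    simp only [base, if_pos h0]
  have hinner : ∀ i, 0 < i → i < S.n → S.seg i ≠ i → φ i = w (base (S.seg (S.par i)))
      (S.seg (S.par i)) (S.lev (S.par i) - S.lev (S.seg (S.par i)) + 1) := by
    intro i h0 hi hs
    have hp := S.par_lt i h0 hi
    have := S.lev_seg_le (S.par i) (by omega)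
    rw [hφ i hi, ← (S.seg_par i hi).resolve_left hs, S.lev_par i h0 hi]
    congr 1
    omega
  have hfwd : ∀ i, i < S.n → D.Adj (φ i)
      (w (base (S.seg i)) (S.seg i) (S.lev i - S.lev (S.seg i) + 1)) := by
    intro i hi
    rw [hφ i hi]
    exact (hw _ _ (hnear i hi).1).2.adj _
  have hnxt : ∀ i, i < S.n → D.Adj (φ i) (nx (φ i)) := fun i hi => (hnx _ (hnear i hi).2).1
  refine ⟨φ, fun i => w (base (S.seg i)) (S.seg i) (S.lev i - S.lev (S.seg i) + 1),
    fun i => nx (φ i), hfwd, hnxt, hroot, hinner, ?_, ?_⟩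
  · intro i
    induction i using Nat.strong_induction_on with
    | _ i ih =>
      intro hi
      rcases Nat.eq_zero_or_pos i with rfl | h0
      · have hs : S.seg 0 = 0 := by have := S.seg_le 0 hi; omega
        have hb := (hnear 0 hi).1
        rw [hφ 0 hi, Nat.sub_eq_zero_of_le (by rw [hs]), (hw _ _ hb).1, hs]
        exact hcc
      · have hp := S.par_lt i h0 hi
        have h1 := ih _ hp (by omega)
        have h2 := htc i h0 hi
        have h3 : D.Adj (φ (S.par i)) (φ i) := by
          by_cases hs : S.seg i = i
          · rw [hroot i h0 hi hs]; exact hnxt _ (by omega)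
          · rw [hinner i h0 hi hs]; exact hfwd _ (by omega)
        have h4 := hcol _ _ h3
        revert h1 h2 h4
        cases col (φ i) <;> cases col (φ (S.par i)) <;> cases tc i <;> cases tc (S.par i) <;> simp
  · intro i hi hl
    rw [hφ i hi]
    exact (hw _ _ (hnear i hi).1).2.eq_or_eq _ (by omega)

/-- Few vertices are in the first levels of their segment. -/
theorem card_first_levels_le (Δ : ℕ) (hΔ : 1 ≤ Δ)
    (hdeg : ∀ j, #{i ∈ range S.n | 0 < i ∧ S.par i = j} ≤ Δ) (m : ℕ) :
    #{i ∈ range S.n | S.lev i < S.lev (S.seg i) + m} ≤ m * (#S.roots * Δ ^ m) := by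
  -- A vertex at relative level `t + 1` is a child, within the same segment, of a vertex at relative
  -- level `t`.
  have hlayer : ∀ t, #{i ∈ range S.n | S.lev i = S.lev (S.seg i) + t} ≤ #S.roots * Δ ^ t := by
    have hpar : ∀ i, i < S.n → S.seg i ≠ i → 0 < i ∧ S.par i < S.n ∧
        S.lev i = S.lev (S.par i) + 1 ∧ S.seg (S.par i) = S.seg i := by
      intro i hi hs
      have h0 : 0 < i := by have := S.seg_le i hi; omega
      have hp := S.par_lt i h0 hi
      exact ⟨h0, by omega, S.lev_par i h0 hi, (S.seg_par i hi).resolve_left hs⟩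
    intro t
    induction t with
    | zero =>
      rw [pow_zero, mul_one]
      refine card_le_card fun i hi => ?_
      obtain ⟨hi, hl⟩ := mem_filter.1 hi
      refine mem_filter.2 ⟨hi, ?_⟩
      rw [mem_range] at hi
      by_contra hs
      obtain ⟨h0, hp, h1, h2⟩ := hpar i hi hs
      have := S.lev_seg_le _ hp
      rw [h2] at this
      omega
    | succ t ih =>
      have hsub : {i ∈ range S.n | S.lev i = S.lev (S.seg i) + (t + 1)} ⊆
          ({i ∈ range S.n | S.lev i = S.lev (S.seg i) + t} : Finset ℕ).biUnion
            (fun j => {i ∈ range S.n | 0 < i ∧ S.par i = j}) := by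
        intro i hi
        obtain ⟨hi, hl⟩ := mem_filter.1 hi
        have hs : S.seg i ≠ i := by intro hs; rw [hs] at hl; omega
        obtain ⟨h0, hp, h1, h2⟩ := hpar i (mem_range.1 hi) hs
        exact mem_biUnion.2 ⟨S.par i, mem_filter.2 ⟨mem_range.2 hp, by rw [h2]; omega⟩,
          mem_filter.2 ⟨hi, h0, rfl⟩⟩
      calc _ ≤ _ := card_le_card hsub
        _ ≤ _ := card_biUnion_le_card_mul _ _ Δ fun j _ => hdeg j
        _ ≤ _ := Nat.mul_le_mul_right Δ ih
        _ = _ := by rw [pow_succ, mul_assoc]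
  have hsub : {i ∈ range S.n | S.lev i < S.lev (S.seg i) + m} ⊆
      (range m).biUnion fun t => {i ∈ range S.n | S.lev i = S.lev (S.seg i) + t} := by
    intro i hi
    obtain ⟨hi, hl⟩ := mem_filter.1 hi
    have := S.lev_seg_le i (mem_range.1 hi)
    exact mem_biUnion.2 ⟨S.lev i - S.lev (S.seg i), mem_range.2 (by omega),
      mem_filter.2 ⟨hi, by omega⟩⟩
  calc _ ≤ _ := card_le_card hsub
    _ ≤ _ := card_biUnion_le_card_mul _ _ (#S.roots * Δ ^ m) fun t ht =>
      (hlayer t).trans (Nat.mul_le_mul_left _ (Nat.pow_le_pow_right hΔ (mem_range.1 ht).le))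
    _ = _ := by rw [card_range]

end SegmentedTree

/-! ### Packing segments into bins -/

/-- Greedy packing of items of size at most `p` into bins, where the item `s` may go to the bins
in `K s`. -/
theorem exists_greedy_packing {ι : Type*} [DecidableEq ι] (J : Finset ℕ) (a : ℕ → ℕ)
    (K : ℕ → Finset ι) (p c : ℕ) (ha : ∀ s, a s ≤ p) (hK : ∀ s, ∑ t ∈ J, a t < #(K s) * c) :
    ∃ y : ℕ → ι, (∀ s, y s ∈ K s) ∧ ∀ i, ∑ s ∈ J with y s = i, a s ≤ c + p := by
  have hne : ∀ s, (K s).Nonempty := fun s => by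
    rw [← card_pos]
    by_contra h
    have h0 : #(K s) = 0 := by omega
    have := hK s
    simp [h0] at this
  choose y₀ hy₀ using hne
  induction J using Finset.induction_on with
  | empty => exact ⟨y₀, hy₀, by simp⟩
  | insert s J hs ih =>
    obtain ⟨y, hy, hl⟩ := ih fun t => lt_of_le_of_lt (sum_le_sum_of_subset (subset_insert _ _)) (hK t)
    obtain ⟨i, hi, hic⟩ : ∃ i ∈ K s, ∑ t ∈ J with y t = i, a t ≤ c := by
      by_contra! h
      have h1 : #(K s) * c ≤ ∑ i ∈ K s, ∑ t ∈ J with y t = i, a t :=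
        card_nsmul_le_sum _ _ _ fun i hi => (h i hi).le
      rw [sum_fiberwise_eq_sum_filter] at h1
      have h2 : ∑ t ∈ J with y t ∈ K s, a t ≤ ∑ t ∈ J, a t :=
        sum_le_sum_of_subset (filter_subset _ _)
      have h3 := hK s
      rw [sum_insert hs] at h3
      omega
    refine ⟨Function.update y s i, fun t => ?_, fun j => ?_⟩
    · rcases eq_or_ne t s with rfl | ht
      · simpa using hi
      · simpa [ht] using hy t
    · have hJ : ({t ∈ J | Function.update y s i t = j} : Finset ℕ) = {t ∈ J | y t = j} := by
        refine filter_congr fun t ht => ?_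
        rw [Function.update_of_ne (ne_of_mem_of_not_mem ht hs)]
      rw [filter_insert, Function.update_self, hJ]
      split_ifs with hij
      · subst hij
        rw [sum_insert (by simp [hs])]
        have := ha s
        omega
      · exact hl j

/-- Balanced packing: every item consists of two parts, which go to the two sides of one of the
bins in `M`, in one of the two possible orders. -/
theorem exists_balanced_packing {β : Type*} [DecidableEq β] (J : Finset ℕ) (a b : ℕ → ℕ)
    (M : Finset β) (p c : ℕ) (hab : ∀ s, a s + b s ≤ p)
    (hM : ∑ s ∈ J, (a s + b s) + #M * p < #M * (2 * c)) :
    ∃ (m : ℕ → β) (σ : ℕ → Bool), (∀ s, m s ∈ M) ∧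
      ∀ e, ∑ s ∈ J with m s = e, (if σ s then b s else a s) ≤ c + p ∧
        ∑ s ∈ J with m s = e, (if σ s then a s else b s) ≤ c + p := by
  have hne : M.Nonempty := by
    rw [← card_pos]
    by_contra h
    have h0 : #M = 0 := by omega
    simp [h0] at hM
  obtain ⟨e₀, he₀⟩ := hne
  -- For the induction, the two sides of each bin are also kept within `p` of each other.
  suffices H : ∃ (m : ℕ → β) (σ : ℕ → Bool), (∀ s, m s ∈ M) ∧
      ∀ e, ∑ s ∈ J with m s = e, (if σ s then b s else a s) ≤ c + p ∧
        ∑ s ∈ J with m s = e, (if σ s then a s else b s) ≤ c + p ∧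
        ∑ s ∈ J with m s = e, (if σ s then b s else a s) ≤
          ∑ s ∈ J with m s = e, (if σ s then a s else b s) + p ∧
        ∑ s ∈ J with m s = e, (if σ s then a s else b s) ≤
          ∑ s ∈ J with m s = e, (if σ s then b s else a s) + p by
    obtain ⟨m, σ, h1, h2⟩ := H
    exact ⟨m, σ, h1, fun e => ⟨(h2 e).1, (h2 e).2.1⟩⟩
  induction J using Finset.induction_on with
  | empty => exact ⟨fun _ => e₀, fun _ => true, fun _ => he₀, by simp⟩
  | insert s J hs ih =>
    rw [sum_insert hs] at hM
    obtain ⟨m, σ, hm, hl⟩ := ih (by omega)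
    set L := fun e => ∑ s ∈ J with m s = e, (if σ s then b s else a s) with hL
    set L' := fun e => ∑ s ∈ J with m s = e, (if σ s then a s else b s) with hL'
    have hl' : ∀ e, L e ≤ c + p ∧ L' e ≤ c + p ∧ L e ≤ L' e + p ∧ L' e ≤ L e + p := hl
    obtain ⟨e, he, hec⟩ : ∃ e ∈ M, L e ≤ c ∧ L' e ≤ c := by
      -- If every bin had a side above `c`, balance would give each a total load of at least `2 * c
      -- - p`, too much for the items in `J`.
      by_contra! h
      have h1 : ∑ e ∈ M, 2 * c ≤ ∑ e ∈ M, (L e + L' e + p) := by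
        refine sum_le_sum fun e he => ?_
        have h2 := h e he
        have h3 := hl' e
        by_cases h4 : L e ≤ c
        · have := h2 h4; omega
        · omega
      rw [sum_add_distrib, sum_add_distrib, sum_const, sum_const, smul_eq_mul, smul_eq_mul] at h1
      have h5 : ∑ e ∈ M, L e + ∑ e ∈ M, L' e ≤ ∑ s ∈ J, (a s + b s) := by
        simp only [hL, hL']
        rw [sum_fiberwise_eq_sum_filter, sum_fiberwise_eq_sum_filter, ← sum_add_distrib]
        refine le_trans (sum_le_sum_of_subset (filter_subset _ _)) (sum_le_sum fun t _ => ?_)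
        split_ifs <;> omega
      omega
    obtain ⟨τ, hτ⟩ : ∃ τ : Bool, L e + (if τ then b s else a s) ≤
        L' e + (if τ then a s else b s) + p ∧
        L' e + (if τ then a s else b s) ≤ L e + (if τ then b s else a s) + p := by
      have h3 := hl' e
      have h4 := hab s
      -- The larger part of the item goes to the lighter side, which preserves the balance.
      by_cases h : (L e ≤ L' e ↔ a s ≤ b s)
      · exact ⟨true, by simp only [if_true]; omega⟩
      · exact ⟨false, by simp only [Bool.false_eq_true, if_false]; omega⟩
    refine ⟨Function.update m s e, Function.update σ s τ, fun t => ?_, fun f => ?_⟩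
    · rcases eq_or_ne t s with rfl | ht
      · simpa using he
      · simpa [ht] using hm t
    · have hJ : ({t ∈ J | Function.update m s e t = f} : Finset ℕ) = {t ∈ J | m t = f} := by
        refine filter_congr fun t ht => ?_
        rw [Function.update_of_ne (ne_of_mem_of_not_mem ht hs)]
      have hσ : ∀ (g g' : ℕ → ℕ), ∑ t ∈ J with m t = f,
          (if Function.update σ s τ t then g t else g' t) =
          ∑ t ∈ J with m t = f, (if σ t then g t else g' t) := by
        intro g g'
        refine sum_congr rfl fun t ht => ?_
        rw [Function.update_of_ne (ne_of_mem_of_not_mem (mem_filter.1 ht).1 hs)]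
      rw [filter_insert, Function.update_self, hJ]
      split_ifs with hef
      · subst hef
        rw [sum_insert (by simp [hs]), sum_insert (by simp [hs]), hσ, hσ, Function.update_self]
        have h3 := hl' e
        have h4 := hab s
        change _ + L e ≤ _ ∧ _ + L' e ≤ _ ∧ _ + L e ≤ _ + L' e + _ ∧ _ + L' e ≤ _ + L e + _
        cases τ <;> simp only [if_true, Bool.false_eq_true, if_false] at hτ ⊢ <;> omega
      · rw [hσ, hσ]
        exact hl f

/-! ### Matchings and packing in the cluster graph -/

namespace SimpleGraph

variable {ι : Type*} {R : SimpleGraph ι}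

/-- `M` is a set of pairwise disjoint edges with ends in `A`. -/
structure IsMatchingIn (R : SimpleGraph ι) (A : Set ι) (M : Finset (ι × ι)) : Prop where
  adj : ∀ e ∈ M, R.Adj e.1 e.2
  left_mem : ∀ e ∈ M, e.1 ∈ A
  right_mem : ∀ e ∈ M, e.2 ∈ A
  disj : ∀ e ∈ M, ∀ f ∈ M, e ≠ f → e.1 ≠ f.1 ∧ e.1 ≠ f.2 ∧ e.2 ≠ f.1 ∧ e.2 ≠ f.2

theorem IsMatchingIn.insert [DecidableEq ι] {A : Set ι} {M : Finset (ι × ι)}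
    (hM : R.IsMatchingIn A M) {u v : ι}
    (huv : R.Adj u v) (hu : u ∈ A) (hv : v ∈ A) (huM : ∀ e ∈ M, e.1 ≠ u ∧ e.2 ≠ u)
    (hvM : ∀ e ∈ M, e.1 ≠ v ∧ e.2 ≠ v) :
    R.IsMatchingIn A (insert (u, v) M) ∧ #(insert (u, v) M) = #M + 1 := by
  refine ⟨⟨?_, ?_, ?_, ?_⟩, card_insert_of_notMem fun h => (huM _ h).1 rfl⟩
  · intro e he
    rcases mem_insert.1 he with rfl | he
    exacts [huv, hM.adj e he]
  · intro e he
    rcases mem_insert.1 he with rfl | he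
    exacts [hu, hM.left_mem e he]
  · intro e he
    rcases mem_insert.1 he with rfl | he
    exacts [hv, hM.right_mem e he]
  · intro e he f hf hef
    rcases mem_insert.1 he with rfl | he <;> rcases mem_insert.1 hf with rfl | hf
    · exact absurd rfl hef
    · exact ⟨(huM f hf).1.symm, (huM f hf).2.symm, (hvM f hf).1.symm, (hvM f hf).2.symm⟩
    · exact ⟨(huM e he).1, (hvM e he).1, (huM e he).2, (hvM e he).2⟩
    · exact hM.disj e he f hf hef

theorem IsMatchingIn.mono {A : Set ι} {M M' : Finset (ι × ι)} (hM : R.IsMatchingIn A M)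
    (h : M' ⊆ M) : R.IsMatchingIn A M' :=
  ⟨fun e he => hM.adj e (h he), fun e he => hM.left_mem e (h he),
    fun e he => hM.right_mem e (h he), fun e he f hf => hM.disj e (h he) f (h hf)⟩

/-- If `K` has at least `2 * h` vertices, each with at least `h` neighbours in `S`, then the edges
with ends in `K` and its neighbourhood contain a matching of size `h`. -/
theorem exists_isMatchingIn [DecidableEq ι] [DecidableRel R.Adj] (S K : Finset ι) (A : Set ι)
    (h : ℕ) (hKA : ∀ u ∈ K, u ∈ A)
    (hA : ∀ u ∈ K, ∀ v ∈ S, R.Adj u v → v ∈ A) (hK : 2 * h ≤ #K)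
    (hdeg : ∀ v ∈ K, h ≤ #{u ∈ S | R.Adj v u}) :
    ∃ M, R.IsMatchingIn A M ∧ #M = h := by
  suffices H : ∀ j ≤ h, ∃ M, R.IsMatchingIn A M ∧ #M = j from H h le_rfl
  intro j
  induction j with
  | zero => exact fun _ => ⟨∅, ⟨by simp, by simp, by simp, by simp⟩, rfl⟩
  | succ j ih =>
    intro hj
    obtain ⟨M, hM, hMj⟩ := ih (by omega)
    let B : Finset ι := M.image Prod.fst ∪ M.image Prod.snd
    have hB : #B ≤ 2 * j := by
      have h1 := card_union_le (M.image Prod.fst) (M.image Prod.snd)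
      have h2 : #(M.image Prod.fst) ≤ #M := card_image_le
      have h3 : #(M.image Prod.snd) ≤ #M := card_image_le
      simp only [B]
      omega
    have hnB : ∀ u, u ∉ B → ∀ e ∈ M, e.1 ≠ u ∧ e.2 ≠ u := by
      intro u hu e he
      simp only [B, mem_union, mem_image, not_or, not_exists, not_and] at hu
      exact ⟨hu.1 e he, hu.2 e he⟩
    have hKB : 1 < #(K \ B) := by
      have := le_card_sdiff B K
      omega
    obtain ⟨u, hu, v, hv, huv⟩ := one_lt_card.1 hKB
    obtain ⟨huK, huB⟩ := mem_sdiff.1 hu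
    obtain ⟨hvK, hvB⟩ := mem_sdiff.1 hv
    by_cases hfree : ∃ w ∈ K \ B, ∃ t ∈ S, R.Adj w t ∧ t ∉ B
    · obtain ⟨w, hw, t, ht, hwt, htB⟩ := hfree
      obtain ⟨hwK, hwB⟩ := mem_sdiff.1 hw
      obtain ⟨h1, h2⟩ := hM.insert hwt (hKA w hwK) (hA w hwK t ht hwt) (hnB w hwB) (hnB t htB)
      exact ⟨_, h1, by omega⟩
    -- All neighbours in `S` of the unmatched vertices `u` and `v` are now covered by the `j < h`
    -- matching edges. Together they send at least `2 * h > 2 * j` edges there, so some `e` in `M`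
    -- can be replaced by two disjoint edges, one from `u` and one from `v`.
    push Not at hfree
    have hsum : ∀ w ∈ K \ B, h ≤ #{e ∈ M | R.Adj w e.1} + #{e ∈ M | R.Adj w e.2} := by
      intro w hw
      refine (hdeg w (mem_sdiff.1 hw).1).trans ?_
      have hsub : ({t ∈ S | R.Adj w t} : Finset ι) ⊆
          ({e ∈ M | R.Adj w e.1} : Finset _).image Prod.fst ∪
          ({e ∈ M | R.Adj w e.2} : Finset _).image Prod.snd := by
        intro t ht
        obtain ⟨htS, hwt⟩ := mem_filter.1 ht
        have := hfree w hw t htS hwt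
        simp only [B, mem_union, mem_image] at this
        rcases this with ⟨e, he, rfl⟩ | ⟨e, he, rfl⟩
        · exact mem_union_left _ (mem_image_of_mem _ (mem_filter.2 ⟨he, hwt⟩))
        · exact mem_union_right _ (mem_image_of_mem _ (mem_filter.2 ⟨he, hwt⟩))
      exact (card_le_card hsub).trans ((card_union_le _ _).trans
        (add_le_add card_image_le card_image_le))
    obtain ⟨e, he, hue⟩ : ∃ e ∈ M, (R.Adj u e.1 ∧ R.Adj v e.2) ∨ (R.Adj v e.1 ∧ R.Adj u e.2) := by
      by_contra! hcon
      have hle : ∀ P Q : ι × ι → Prop, ∀ [DecidablePred P] [DecidablePred Q],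
          (∀ e ∈ M, P e → ¬ Q e) → #{e ∈ M | P e} + #{e ∈ M | Q e} ≤ #M := by
        intro P Q _ _ hPQ
        rw [← card_union_of_disjoint]
        · exact card_le_card (union_subset (filter_subset _ _) (filter_subset _ _))
        · rw [disjoint_filter]
          exact hPQ
      have h1 := hle (fun e => R.Adj u e.1) (fun e => R.Adj v e.2) fun e he => (hcon e he).1
      have h2 := hle (fun e => R.Adj v e.1) (fun e => R.Adj u e.2) fun e he => (hcon e he).2
      have h3 := hsum u hu
      have h4 := hsum v hv
      omega
    have haug : ∀ w t, w ∈ K \ B → t ∈ K \ B → w ≠ t → R.Adj w e.1 → R.Adj t e.2 →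
        ∃ M, R.IsMatchingIn A M ∧ #M = j + 1 := by
      intro w t hw ht hwt hwe hte
      obtain ⟨hwK, hwB⟩ := mem_sdiff.1 hw
      obtain ⟨htK, htB⟩ := mem_sdiff.1 ht
      have hMe := hM.mono (erase_subset e M)
      have hcard := card_erase_add_one he
      have hw' := hnB w hwB
      have ht' := hnB t htB
      obtain ⟨h1, h2⟩ := hMe.insert hwe (hKA w hwK) (hM.left_mem e he)
        (fun f hf => hw' f (mem_of_mem_erase hf))
        (fun f hf => by
          have := hM.disj f (mem_of_mem_erase hf) e he (ne_of_mem_erase hf)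
          exact ⟨this.1, this.2.2.1⟩)
      obtain ⟨h3, h4⟩ := h1.insert hte (hKA t htK) (hM.right_mem e he)
        (fun f hf => by
          rcases mem_insert.1 hf with rfl | hf
          · exact ⟨hwt, (ht' e he).1⟩
          · exact ht' f (mem_of_mem_erase hf))
        (fun f hf => by
          rcases mem_insert.1 hf with rfl | hf
          · exact ⟨(hw' e he).2.symm, (hM.adj e he).ne⟩
          · have := hM.disj f (mem_of_mem_erase hf) e he (ne_of_mem_erase hf)
            exact ⟨this.2.1, this.2.2.2⟩)
      exact ⟨_, h3, by omega⟩
    rcases hue with ⟨h1, h2⟩ | ⟨h1, h2⟩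
    · exact haug u v hu hv huv h1 h2
    · exact haug v u hv hu huv.symm h1 h2

/-- The bipartite double cover of a graph. -/
def doubleCover (R : SimpleGraph ι) : SimpleGraph (ι × Bool) where
  Adj a b := R.Adj a.1 b.1 ∧ a.2 ≠ b.2
  symm.symm _ _ h := ⟨h.1.symm, h.2.symm⟩
  loopless.irrefl _ h := h.2 rfl

/-- Packing of items with two parts into adjacent vertices close to a vertex `x` of large degree. -/
theorem exists_packing [DecidableEq ι] [DecidableRel R.Adj] (S : Finset ι) (x : ι) (h : ℕ)
    (hx : 2 * h ≤ #{u ∈ S | R.Adj x u}) (hS : ∀ v ∈ S, h ≤ #{u ∈ S | R.Adj v u}) (J : Finset ℕ)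
    (a b : ℕ → ℕ) (p c : ℕ) (hab : ∀ s, a s + b s ≤ p) (hb : ∑ s ∈ J, b s < h * c)
    (hsum : ∑ s ∈ J, (a s + b s) + h * p < h * (2 * c)) :
    ∃ y z : ℕ → ι, (∀ s, R.Adj (y s) (z s)) ∧
      (∀ s, R.doubleCover.Near (x, true) 5 (y s, false)) ∧
      (∀ s, R.doubleCover.Near (x, true) 5 (z s, true)) ∧
      ∀ i, ∑ s ∈ J with y s = i, a s + ∑ s ∈ J with z s = i, b s ≤ c + p := by
  set K : Finset ι := {u ∈ S | R.Adj x u} with hKdef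
  have hstep : ∀ {u v : ι} {t : ℕ} {β : Bool}, R.doubleCover.Near (x, true) t (v, !β) →
      R.Adj u v → R.doubleCover.Near (x, true) (t + 1) (u, β) := by
    intro u v t β hv huv
    exact hv.step (a := (u, β)) ⟨huv, by simp⟩
  have h0 : R.doubleCover.Near (x, true) 0 (x, !false) := near_self _ _ _
  have hK0 : ∀ u ∈ K, R.doubleCover.Near (x, true) 1 (u, !true) := fun u hu =>
    hstep h0 (mem_filter.1 hu).2.symm
  -- An edge in `K` closes a triangle with `x`, so `(x, false)` is within distance 3 of `(x, true)`.
  -- Both copies of a vertex of `K` are then within distance 4, and both copies of its neighbours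
  -- within 5; this is the origin of the radius.
  by_cases hodd : ∃ u ∈ K, ∃ v ∈ K, R.Adj u v
  · obtain ⟨u, hu, v, hv, huv⟩ := hodd
    have hx' : R.doubleCover.Near (x, true) 3 (x, !true) :=
      hstep (β := false) (hstep (β := true) (hK0 u hu) huv.symm) (mem_filter.1 hv).2
    have hK1 : ∀ u ∈ K, R.doubleCover.Near (x, true) 4 (u, !false) := fun u hu =>
      hstep hx' (mem_filter.1 hu).2.symm
    obtain ⟨M, hM, hMh⟩ := exists_isMatchingIn (R := R) S K
      {u | ∀ β, R.doubleCover.Near (x, true) 5 (u, β)} h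
      (fun u hu β => by
        cases β
        · exact (hK0 u hu).mono (by norm_num)
        · exact (hK1 u hu).mono (by norm_num))
      (fun u hu v _ huv β => by
        cases β
        · exact hstep (hK1 u hu) huv.symm
        · exact (hstep (hK0 u hu) huv.symm).mono (by norm_num))
      hx (fun v hv => hS v (mem_filter.1 hv).1)
    obtain ⟨m, σ, hm, hl⟩ := exists_balanced_packing J a b M p c hab (by rwa [hMh])
    refine ⟨fun s => if σ s then (m s).2 else (m s).1, fun s => if σ s then (m s).1 else (m s).2,
      ?_, ?_, ?_, ?_⟩
    · intro s
      have := hM.adj _ (hm s)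
      dsimp only
      split_ifs
      exacts [this.symm, this]
    · intro s
      dsimp only
      split_ifs
      exacts [hM.right_mem _ (hm s) _, hM.left_mem _ (hm s) _]
    · intro s
      dsimp only
      split_ifs
      exacts [hM.left_mem _ (hm s) _, hM.right_mem _ (hm s) _]
    · intro i
      rw [sum_filter, sum_filter, ← sum_add_distrib]
      by_cases hi : ∃ e ∈ M, e.1 = i ∨ e.2 = i
      · obtain ⟨e, he, hie⟩ := hi
        have hother : ∀ s, m s ≠ e → (m s).1 ≠ i ∧ (m s).2 ≠ i := by
          intro s hs
          have := hM.disj _ (hm s) e he hs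
          rcases hie with rfl | rfl
          · exact ⟨this.1, this.2.2.1⟩
          · exact ⟨this.2.1, this.2.2.2⟩
        have hne := (hM.adj e he).ne
        have h1 := (hl e).1
        have h2 := (hl e).2
        rw [sum_filter] at h1 h2
        rcases hie with hie | hie
        · refine le_trans (sum_le_sum fun s _ => ?_) h1
          by_cases hs : m s = e
          · have h3 : e.2 ≠ i := hie ▸ hne.symm
            cases hσ : σ s <;> simp [hσ, hs, hie, h3]
          · have := hother s hs
            cases hσ : σ s <;> simp [hσ, hs, this]
        · refine le_trans (sum_le_sum fun s _ => ?_) h2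
          by_cases hs : m s = e
          · have h3 : e.1 ≠ i := hie ▸ hne
            cases hσ : σ s <;> simp [hσ, hs, hie, h3]
          · have := hother s hs
            cases hσ : σ s <;> simp [hσ, hs, this]
      · push Not at hi
        rw [sum_eq_zero]
        · omega
        · intro s _
          have := hi _ (hm s)
          cases hσ : σ s <;> simp [hσ, this]
  -- Here `K` is independent, so no `z s` lies in `K` while every `y s` does: no cluster receives
  -- both kinds of load.
  · push Not at hodd
    obtain ⟨y, hy, hly⟩ := exists_greedy_packing J a (fun _ => K) p c
      (fun s => by have := hab s; omega) (fun _ => by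
        rw [sum_add_distrib] at hsum
        calc ∑ t ∈ J, a t < h * (2 * c) := by omega
          _ = (2 * h) * c := by ring
          _ ≤ #K * c := Nat.mul_le_mul_right c hx)
    obtain ⟨z, hz, hlz⟩ := exists_greedy_packing J b (fun s => {u ∈ S | R.Adj (y s) u}) p c
      (fun s => by have := hab s; omega) (fun s =>
        hb.trans_le (Nat.mul_le_mul_right c (hS _ (mem_filter.1 (hy s)).1)))
    have hyz : ∀ s, R.Adj (y s) (z s) := fun s => (mem_filter.1 (hz s)).2
    refine ⟨y, z, hyz, fun s => (hK0 _ (hy s)).mono (by norm_num),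
      fun s => (hstep (hK0 _ (hy s)) (hyz s).symm).mono (by norm_num), fun i => ?_⟩
    by_cases hi : i ∈ K
    · have : ({s ∈ J | z s = i} : Finset ℕ) = ∅ := by
        rw [filter_eq_empty_iff]
        rintro s - rfl
        exact hodd _ (hy s) _ hi (hyz s)
      rw [this, sum_empty]
      exact hly i
    · have : ({s ∈ J | y s = i} : Finset ℕ) = ∅ := by
        rw [filter_eq_empty_iff]
        rintro s - rfl
        exact hi (hy s)
      rw [this, sum_empty, zero_add]
      exact hlz i

/-- A graph of average degree at least `d` has an induced subgraph of minimum degree at least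
`d / 2` and maximum degree at least `d`. -/
theorem exists_induced_degree [DecidableEq ι] [DecidableRel R.Adj] [Fintype ι] [Nonempty ι]
    (d : ℝ) (hd : 0 < d)
    (h : d * Fintype.card ι ≤ ∑ v : ι, (#{u | R.Adj v u} : ℝ)) :
    ∃ S : Finset ι, (∃ x ∈ S, d ≤ #{u ∈ S | R.Adj x u}) ∧
      ∀ v ∈ S, d / 2 ≤ #{u ∈ S | R.Adj v u} := by
  -- Deleting a vertex of degree below `d / 2` lowers the degree sum by less than `d`, so it would
  -- leave a smaller set of average degree at least `d`.
  obtain ⟨S, hS, hmin⟩ := exists_min_image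
    ({S | S.Nonempty ∧ d * #S ≤ ∑ v ∈ S, (#{u ∈ S | R.Adj v u} : ℝ)} : Finset (Finset ι)) card
    ⟨univ, mem_filter.2 ⟨mem_univ _, univ_nonempty, by rw [card_univ]; exact h⟩⟩
  obtain ⟨-, hne, hsum⟩ := mem_filter.1 hS
  refine ⟨S, ?_, ?_⟩
  · refine exists_le_of_sum_le hne ?_
    rw [sum_const, nsmul_eq_mul, mul_comm]
    exact hsum
  · intro v hv
    by_contra! hlt
    have hcard : (#(S.erase v) : ℝ) + 1 = #S := by exact_mod_cast card_erase_add_one hv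
    have hdeg : ∀ w ∈ S, (#{u ∈ S | R.Adj w u} : ℝ) =
        #{u ∈ S.erase v | R.Adj w u} + if R.Adj w v then 1 else 0 := by
      intro w hw
      conv_lhs => rw [← insert_erase hv, filter_insert]
      split_ifs with hwv
      · rw [card_insert_of_notMem (by simp)]
        push_cast
        rfl
      · simp
    have hv1 : (#{u ∈ S.erase v | R.Adj v u} : ℝ) = #{u ∈ S | R.Adj v u} := by
      rw [hdeg v hv]; simp
    have hv2 : (∑ w ∈ S.erase v, if R.Adj w v then (1 : ℝ) else 0) =
        #{u ∈ S.erase v | R.Adj v u} := by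
      rw [sum_boole]
      congr 2
      exact filter_congr fun u _ => R.adj_comm u v
    have htot : ∑ w ∈ S, (#{u ∈ S | R.Adj w u} : ℝ) =
        ∑ w ∈ S.erase v, (#{u ∈ S.erase v | R.Adj w u} : ℝ) + 2 * #{u ∈ S | R.Adj v u} := by
      rw [← add_sum_erase S _ hv, sum_congr rfl (fun w hw => hdeg w (mem_of_mem_erase hw)),
        sum_add_distrib, hv2, hv1]
      ring
    have hne' : (S.erase v).Nonempty := by
      by_contra hemp
      rw [not_nonempty_iff_eq_empty] at hemp
      rw [hemp] at hv1 hcard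
      rw [htot, hemp, ← hcard, ← hv1] at hsum
      simp at hsum
      linarith
    have := hmin (S.erase v) (mem_filter.2 ⟨mem_univ _, hne', by
      rw [← hcard] at hsum
      linarith⟩)
    have := card_erase_lt_of_mem hv
    omega

end SimpleGraph

/-! ### Embedding over a reduced graph -/

namespace SegmentedTree

variable (S : SegmentedTree)

theorem seg_mem_roots {i : ℕ} (hi : i < S.n) : S.seg i ∈ S.roots :=
  mem_filter.2 ⟨mem_range.2 ((S.seg_le i hi).trans_lt hi), S.seg_seg i hi⟩

/-- A proper colouring of a segmented tree whose colour class `true` is not the larger one. -/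
theorem exists_coloring : ∃ tc : ℕ → Bool, (∀ i, 0 < i → i < S.n → tc i ≠ tc (S.par i)) ∧
    2 * #{i ∈ range S.n | tc i = true} ≤ S.n := by
  have h1 := card_filter_add_card_filter_not (s := range S.n) (fun i => S.lev i % 2 = 0)
  rw [card_range] at h1
  by_cases h : 2 * #{i ∈ range S.n | S.lev i % 2 = 0} ≤ S.n
  · refine ⟨fun i => decide (S.lev i % 2 = 0), fun i h0 hi => ?_, by simpa using h⟩
    dsimp only; rw [S.lev_par i h0 hi]
    rcases Nat.mod_two_eq_zero_or_one (S.lev (S.par i)) with h' | h'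
    · have : (S.lev (S.par i) + 1) % 2 = 1 := by omega
      simp [h', this]
    · have : (S.lev (S.par i) + 1) % 2 = 0 := by omega
      simp [h', this]
  · refine ⟨fun i => decide (¬ S.lev i % 2 = 0), fun i h0 hi => ?_, ?_⟩
    · dsimp only; rw [S.lev_par i h0 hi]
      rcases Nat.mod_two_eq_zero_or_one (S.lev (S.par i)) with h' | h'
      · have : (S.lev (S.par i) + 1) % 2 = 1 := by omega
        simp [h', this]
      · have : (S.lev (S.par i) + 1) % 2 = 0 := by omega
        simp [h', this]
    · simp only [decide_eq_true_eq]
      omega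

/-- Embedding of a segmented tree into a graph with a reduced graph `R` on the clusters `C i`. -/
theorem exists_embedding_of_reduced {V ι : Type*} [DecidableEq V] [DecidableEq ι]
    (G : SimpleGraph V) [DecidableRel G.Adj] (C : ι → Finset V)
    (hC : ∀ a b, a ≠ b → Disjoint (C a) (C b)) (R : SimpleGraph ι) [DecidableRel R.Adj]
    (θ κ τ p N Δ c h : ℕ)
    (hR : ∀ a b, R.Adj a b → ∀ B ⊆ C b, θ ≤ #B → #{v ∈ C a | #{u ∈ B | G.Adj v u} < κ} ≤ τ)
    (hκ : 2 * τ + p + N < κ) (hθ : κ ≤ θ) (A : Finset ι) (x : ι)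
    (hx : 2 * h ≤ #{u ∈ A | R.Adj x u}) (hA : ∀ v ∈ A, h ≤ #{u ∈ A | R.Adj v u})
    (hp : ∀ i, i < S.n → i < S.seg i + p) (hN : #S.roots ≤ N) (hΔ : 1 ≤ Δ)
    (hdeg : ∀ j, #{i ∈ range S.n | 0 < i ∧ S.par i = j} ≤ Δ)
    (hsum : S.n + h * p < h * (2 * c))
    (hsize : ∀ i, 2 * θ + (c + p + 10 * (N * Δ ^ 10)) ≤ #(C i)) :
    ∃ f : ℕ → V, Set.InjOn f (Set.Iio S.n) ∧
      ∀ i, 0 < i → i < S.n → G.Adj (f (S.par i)) (f i) := by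
  -- The class `true` is at most half of the tree; it is the part `b` in `exists_packing`, which
  -- must fit into only `h` clusters.
  obtain ⟨tc, htc, htc2⟩ := S.exists_coloring
  let w : Bool → ℕ → ℕ := fun β s => #{i ∈ range S.n | S.seg i = s ∧ tc i = β}
  have hw : ∀ β (P : ℕ → Prop) [DecidablePred P], ∑ s ∈ S.roots with P s, w β s =
      #{i ∈ range S.n | tc i = β ∧ P (S.seg i)} := by
    intro β P _
    rw [card_eq_sum_card_fiberwise (f := S.seg) (t := {s ∈ S.roots | P s})]
    · refine sum_congr rfl fun s hs => ?_
      simp only [w, filter_filter]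
      congr 1
      refine filter_congr fun i _ => ?_
      constructor
      · rintro ⟨rfl, h⟩
        exact ⟨⟨h, (mem_filter.1 hs).2⟩, rfl⟩
      · rintro ⟨⟨h, -⟩, rfl⟩
        exact ⟨rfl, h⟩
    · intro i hi
      obtain ⟨hi, -, hP⟩ := mem_filter.1 (mem_coe.1 hi)
      exact mem_coe.2 (mem_filter.2 ⟨S.seg_mem_roots (mem_range.1 hi), hP⟩)
  have hwtot : ∀ β, ∑ s ∈ S.roots, w β s = #{i ∈ range S.n | tc i = β} := by
    intro β
    have := hw β (fun _ => True)
    simpa using this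
  have hsplit : #{i ∈ range S.n | tc i = false} + #{i ∈ range S.n | tc i = true} = S.n := by
    have := card_filter_add_card_filter_not (s := range S.n) (fun i => tc i = false)
    simpa using this
  have hab : ∀ s, w false s + w true s ≤ p := by
    intro s
    simp only [w]
    rw [← card_union_of_disjoint]
    · refine (card_le_card (t := Ico s (s + p)) ?_).trans (by simp)
      intro i hi
      have hi' : i < S.n ∧ S.seg i = s := by
        simp only [mem_union, mem_filter, mem_range] at hi
        tauto
      have h1 := S.seg_le i hi'.1
      have h2 := hp i hi'.1
      rw [hi'.2] at h1 h2
      exact mem_Ico.2 ⟨h1, h2⟩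
    · rw [disjoint_filter]
      rintro i - ⟨-, h1⟩ ⟨-, h2⟩
      rw [h1] at h2
      exact Bool.noConfusion h2
  obtain ⟨y, z, hyz, hy, hz, hload⟩ := SimpleGraph.exists_packing A x h hx hA S.roots (w false)
    (w true) p c hab (by
      rw [hwtot]
      have : h * (2 * c) = 2 * (h * c) := by ring
      omega) (by
      rw [sum_add_distrib, hwtot, hwtot, hsplit]
      exact hsum)
  have hh : 0 < h := by
    by_contra h0
    have : h = 0 := by omega
    simp [this] at hsum
  obtain ⟨u, hu⟩ : ({u ∈ A | R.Adj x u} : Finset ι).Nonempty := card_pos.1 (by omega)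
  obtain ⟨φ, fwd, nxt, h1, h2, h3, h4, h5, h6⟩ := S.exists_assignment R.doubleCover Prod.snd
    (fun _ _ h => h.2) (x, true) 5 (by norm_num) ⟨(u, false), (mem_filter.1 hu).2, by simp⟩
    (fun s => (y s, false)) (fun s => (z s, true)) (fun s => ⟨hyz s, by simp⟩) hy hz tc htc
  refine S.exists_embedding G C hC R.Adj θ κ τ p N hR hκ hθ (fun i => (φ i).1)
    (fun i => (fwd i).1) (fun i => (nxt i).1) (fun i hi => (h1 i hi).1) (fun i hi => (h2 i hi).1)
    (fun i h0 hi hs => congrArg Prod.fst (h3 i h0 hi hs))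
    (fun i h0 hi hs => congrArg Prod.fst (h4 i h0 hi hs)) (fun j => ?_) hp hN
  refine le_trans (Nat.add_le_add_left ?_ _) (hsize j)
  -- After `10 = 2 * 5` levels a segment has reached its edge, so it contributes only the load
  -- planned by the packing; earlier vertices may go anywhere and are all charged to `j`.
  have hsub : {i ∈ range S.n | (φ i).1 = j} ⊆
      ({i ∈ range S.n | tc i = false ∧ y (S.seg i) = j} ∪
        {i ∈ range S.n | tc i = true ∧ z (S.seg i) = j}) ∪
      {i ∈ range S.n | S.lev i < S.lev (S.seg i) + 10} := by
    intro i hi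
    obtain ⟨hi, hj⟩ := mem_filter.1 hi
    have hin := mem_range.1 hi
    by_cases hl : S.lev i < S.lev (S.seg i) + 10
    · exact mem_union_right _ (mem_filter.2 ⟨hi, hl⟩)
    · refine mem_union_left _ (mem_union.2 ?_)
      have hcol := h5 i hin
      rcases h6 i hin (by omega) with he | he <;> rw [he] at hj hcol
      · exact Or.inl (mem_filter.2 ⟨hi, hcol.symm, hj⟩)
      · exact Or.inr (mem_filter.2 ⟨hi, hcol.symm, hj⟩)
  refine (card_le_card hsub).trans ((card_union_le _ _).trans (add_le_add
    ((card_union_le _ _).trans ?_) ((S.card_first_levels_le Δ hΔ hdeg 10).trans ?_)))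
  · rw [← hw false (fun s => y s = j), ← hw true (fun s => z s = j)]
    exact hload j
  · gcongr

end SegmentedTree

/-! ### Regular pairs and the density of the cluster graph -/

namespace SimpleGraph

/-- In a uniform dense pair, most vertices of one side have many neighbours in any given large
subset of the other side. -/
theorem IsUniform.card_low_degree_le {V : Type*} [DecidableEq V] {G : SimpleGraph V}
    [DecidableRel G.Adj] {ε d : ℝ} {s t : Finset V} (h : G.IsUniform ε s t)
    (hd : d ≤ G.edgeDensity s t) {B : Finset V} (hB : B ⊆ t) (hBt : (#t : ℝ) * ε ≤ #B)
    (hB0 : 0 < #B) {κ : ℕ} (hκ : (κ : ℝ) ≤ (d - ε) * #B) :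
    (#{v ∈ s | #{u ∈ B | G.Adj v u} < κ} : ℝ) ≤ #s * ε := by
  -- Too many low-degree vertices would form a set large enough for uniformity, yet of density at
  -- most `d - ε` to `B`.
  by_contra! hlt
  set b : Finset V := {v ∈ s | #{u ∈ B | G.Adj v u} < κ} with hb
  have h1 := h (filter_subset _ _ : b ⊆ s) hB hlt.le hBt
  have hb0 : (0 : ℝ) < #b := lt_of_le_of_lt (mul_nonneg (Nat.cast_nonneg _) h.pos.le) hlt
  have hB0' : (0 : ℝ) < #B := by exact_mod_cast hB0
  have h2 : #(Rel.interedges G.Adj b B) ≤ #b * κ := by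
    rw [Rel.interedges_eq_biUnion]
    refine card_biUnion_le.trans ?_
    rw [← smul_eq_mul]
    refine sum_le_card_nsmul _ _ _ fun v hv => ?_
    rw [card_map]
    exact (mem_filter.1 hv).2.le
  have h3 : (G.edgeDensity b B : ℝ) ≤ d - ε := by
    rw [edgeDensity_def]
    push_cast
    rw [div_le_iff₀ (mul_pos hb0 hB0')]
    calc (#(G.interedges b B) : ℝ) ≤ #b * κ := by exact_mod_cast h2
      _ ≤ #b * ((d - ε) * #B) := by gcongr
      _ = _ := by ring
  rw [abs_sub_lt_iff] at h1
  linarith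

variable {V : Type*} [DecidableEq V] [Fintype V] (G : SimpleGraph V) [DecidableRel G.Adj]

/-- The graph on the parts of a partition, in which two parts are adjacent if they are a uniform
pair of density at least `d`. -/
def clusterGraph (P : Finpartition (univ : Finset V)) (ε d : ℝ) : SimpleGraph P.parts where
  Adj U W := U ≠ W ∧ G.IsUniform ε U.1 W.1 ∧ d ≤ G.edgeDensity U.1 W.1
  symm.symm U W h := ⟨h.1.symm, h.2.1.symm, by rw [edgeDensity_comm]; exact h.2.2⟩
  loopless.irrefl _ h := h.1 rfl

/-- For a uniform equipartition, the cluster graph inherits the edge density of `G`. -/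
theorem sum_degree_le_clusterGraph [Nonempty V] {P : Finpartition (univ : Finset V)}
    {ε d γ : ℝ} (hε : 0 < ε) (hd : 0 ≤ d) (hγ : 0 < γ) (hP : P.IsEquipartition)
    (hPu : P.IsUniform G ε) (hPγ : 4 / γ ≤ #P.parts) [DecidableRel (G.clusterGraph P ε d).Adj] :
    ∑ v, (G.degree v : ℝ) ≤ (4 * ε + γ / 2 + 4 * d) * (Fintype.card V : ℝ) ^ 2 +
      (∑ U, (#{W | (G.clusterGraph P ε d).Adj U W} : ℝ)) *
        ((Fintype.card V / #P.parts : ℕ) + 1 : ℝ) ^ 2 := by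
  set L := Fintype.card V / #P.parts
  let R : Finset (P.parts × P.parts) := {p | (G.clusterGraph P ε d).Adj p.1 p.2}
  -- An edge of `G` lies in a non-uniform pair, inside a part, in a sparse pair, or over an edge of
  -- the cluster graph. The first three cases give the terms with `4 * ε`, `γ / 2` and `4 * d`.
  have hsub : ({p : V × V | G.Adj p.1 p.2} : Finset (V × V)) ⊆
      (((P.nonUniforms G ε).biUnion fun (U, W) => U ×ˢ W) ∪ P.parts.biUnion offDiag ∪
        (P.sparsePairs G d).biUnion fun (U, W) => G.interedges U W) ∪
      R.biUnion fun p => p.1.1 ×ˢ p.2.1 := by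
    rintro ⟨u, v⟩ huv
    have hadj : G.Adj u v := (mem_filter.1 huv).2
    obtain ⟨U, hU, hu⟩ := P.exists_mem (mem_univ u)
    obtain ⟨W, hW, hv⟩ := P.exists_mem (mem_univ v)
    simp only [mem_union, mem_biUnion, Prod.exists, mem_product, mem_offDiag,
      Finpartition.mk_mem_nonUniforms, Finpartition.mk_mem_sparsePairs, mk_mem_interedges_iff]
    by_cases hUW : U = W
    · subst hUW
      exact Or.inl (Or.inl (Or.inr ⟨U, hU, hu, hv, hadj.ne⟩))
    by_cases hunif : G.IsUniform ε U W
    · by_cases hdens : d ≤ G.edgeDensity U W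
      · refine Or.inr ⟨⟨U, hU⟩, ⟨W, hW⟩, mem_filter.2 ⟨mem_univ _, ?_, hunif, hdens⟩, hu, hv⟩
        exact fun h => hUW (congrArg Subtype.val h)
      · exact Or.inl (Or.inr ⟨U, W, ⟨hU, hW, hUW, not_le.1 hdens⟩, hu, hv, hadj⟩)
    · exact Or.inl (Or.inl (Or.inl ⟨U, W, ⟨hU, hW, hUW, hunif⟩, hu, hv⟩))
  have hdegsum : ∑ v, (G.degree v : ℝ) = #({p : V × V | G.Adj p.1 p.2} : Finset (V × V)) := by
    rw [card_filter, ← univ_product_univ, sum_product]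
    push_cast
    refine sum_congr rfl fun v _ => ?_
    rw [← card_neighborFinset_eq_degree, neighborFinset_eq_filter, card_filter]
    push_cast
    rfl
  have hRsum : ∑ U, (#{W | (G.clusterGraph P ε d).Adj U W} : ℝ) = #R := by
    simp only [R]
    rw [card_filter, ← univ_product_univ, sum_product]
    push_cast
    refine sum_congr rfl fun v _ => ?_
    rw [card_filter]
    push_cast
    rfl
  have hRcard : #(R.biUnion fun p => p.1.1 ×ˢ p.2.1) ≤ #R * (L + 1) ^ 2 := by
    refine card_biUnion_le_card_mul _ _ _ fun p _ => ?_
    rw [card_product, sq]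
    have h1 := hP.card_part_le_average_add_one p.1.2
    have h2 := hP.card_part_le_average_add_one p.2.2
    rw [card_univ] at h1 h2
    exact Nat.mul_le_mul h1 h2
  have h1 := hP.sum_nonUniforms_lt univ_nonempty hε hPu
  have h2 := hP.card_biUnion_offDiag_le hγ hPγ
  have h3 := hP.card_interedges_sparsePairs_le (G := G) (ε := d) hd
  rw [card_univ] at h1 h2 h3
  have h4 := card_le_card hsub
  have h5 := h4.trans ((card_union_le _ _).trans (add_le_add ((card_union_le _ _).trans
    (Nat.add_le_add_right (card_union_le _ _) _)) hRcard))
  have h6 : (#({p : V × V | G.Adj p.1 p.2} : Finset (V × V)) : ℝ) ≤ _ := Nat.cast_le.2 h5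
  push_cast at h6
  rw [hdegsum, hRsum]
  linarith

end SimpleGraph

/-- The numerical relation between the degree sum of a graph with `n` vertices and the degree sum
`s` of its cluster graph with `m` clusters of size `l`. -/
theorem exists_average_of_sum_le {δ ε n k m l s t : ℝ} (hδ : 0 < δ) (hδ1 : δ ≤ 1)
    (hεδ : 64 * ε ≤ δ ^ 2) (hm : 32 / δ ^ 2 ≤ m) (hL : 40 / δ ≤ l) (hn0 : 0 ≤ n) (hk0 : 0 ≤ k)
    (hk : δ * n ≤ k) (hmL : m * l ≤ n) (hdeg : (1 + δ) * k * n < t)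
    (hsum : t ≤ (4 * ε + δ ^ 2 / 8 / 2 + 4 * (δ ^ 2 / 64)) * n ^ 2 + s * (l + 1) ^ 2) :
    ∃ d, d * m = s ∧ (1 + 5 * δ / 8) * k ≤ d * l ∧ 32 ≤ δ * d := by
  have hm0 : 0 < m := lt_of_lt_of_le (by positivity) hm
  have hl0 : 0 < l := lt_of_lt_of_le (by positivity) hL
  have hδl : 40 ≤ l * δ := (div_le_iff₀ hδ).1 hL
  have hs : (1 + 3 * δ / 4) * k * (m * l) ≤ s * (l + 1) ^ 2 := by
    have h1 : (4 * ε + δ ^ 2 / 8 / 2 + 4 * (δ ^ 2 / 64)) * n ^ 2 ≤ δ / 4 * k * n := by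
      calc (4 * ε + δ ^ 2 / 8 / 2 + 4 * (δ ^ 2 / 64)) * n ^ 2 ≤ (δ ^ 2 / 4) * n ^ 2 := by
            gcongr
            linarith [sq_nonneg δ]
        _ = δ / 4 * (δ * n) * n := by ring
        _ ≤ δ / 4 * k * n := by gcongr
    calc (1 + 3 * δ / 4) * k * (m * l) ≤ (1 + 3 * δ / 4) * k * n := by gcongr
      _ ≤ s * (l + 1) ^ 2 := by linarith
  obtain ⟨d, hds⟩ : ∃ d, d * m = s := ⟨s / m, div_mul_cancel₀ _ hm0.ne'⟩
  have hdl : (1 + 5 * δ / 8) * k ≤ d * l := by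
    have h1 : (1 + 3 * δ / 4) * k * l ≤ d * (l + 1) ^ 2 := by
      rw [← hds] at hs
      refine le_of_mul_le_mul_left ?_ hm0
      linarith
    -- Parts may have `l + 1` vertices; since `40 ≤ l * δ`, this rounding costs only `δ / 8`.
    have h2 : (1 + 5 * δ / 8) * (l + 1) ^ 2 ≤ (1 + 3 * δ / 4) * l ^ 2 := by
      have h3 : 1 ≤ l := by nlinarith
      have h4 : δ / 8 * l ^ 2 ≥ 5 * l := by nlinarith
      have h5 : δ * (2 * l + 1) ≤ 1 * (2 * l + 1) := by gcongr
      nlinarith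
    refine le_of_mul_le_mul_right ?_ (show (0 : ℝ) < (l + 1) ^ 2 by positivity)
    calc (1 + 5 * δ / 8) * k * (l + 1) ^ 2 = k * ((1 + 5 * δ / 8) * (l + 1) ^ 2) := by
          ring
      _ ≤ k * ((1 + 3 * δ / 4) * l ^ 2) := by gcongr
      _ = (1 + 3 * δ / 4) * k * l * l := by ring
      _ ≤ d * (l + 1) ^ 2 * l := by gcongr
      _ = _ := by ring
  have hd1 : 32 ≤ δ * d := by
    have h1 : δ * m ≤ d := by
      refine le_of_mul_le_mul_right ?_ hl0
      calc δ * m * l = δ * (m * l) := by ring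
        _ ≤ δ * n := by gcongr
        _ ≤ k := hk
        _ ≤ (1 + 5 * δ / 8) * k := le_mul_of_one_le_left hk0 (by linarith)
        _ ≤ d * l := hdl
    calc 32 ≤ m * δ ^ 2 := (div_le_iff₀ (by positivity)).1 hm
      _ = δ * (δ * m) := by ring
      _ ≤ δ * d := by gcongr
  exact ⟨d, hds, hdl, hd1⟩

namespace SimpleGraph

variable {V : Type*} [DecidableEq V] [Fintype V] (G : SimpleGraph V) [DecidableRel G.Adj]

/-- A graph of average degree more than `(1 + δ) * k` has a cluster graph with a subgraph on `A`
of minimum degree at least `h`, with a vertex of degree at least `2 * h`, where `2 * h` clusters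
have in total at least `(1 + δ / 2) * k` vertices. -/
theorem exists_dense_clusters [Nonempty V] {P : Finpartition (univ : Finset V)} {δ ε : ℝ} {k : ℕ}
    (hδ : 0 < δ) (hδ1 : δ ≤ 1) (hε : 0 < ε) (hεδ : 64 * ε ≤ δ ^ 2) (hP : P.IsEquipartition)
    (hPu : P.IsUniform G ε) (hm : 32 / δ ^ 2 ≤ #P.parts)
    (hL : 40 / δ ≤ (Fintype.card V / #P.parts : ℕ)) (hk : δ * Fintype.card V ≤ k)
    (hdeg : (1 + δ) * k * Fintype.card V < ∑ v, (G.degree v : ℝ))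
    [DecidableRel (G.clusterGraph P ε (δ ^ 2 / 64)).Adj] :
    ∃ (A : Finset P.parts) (x : P.parts) (h : ℕ),
      2 * h ≤ #{u ∈ A | (G.clusterGraph P ε (δ ^ 2 / 64)).Adj x u} ∧
      (∀ v ∈ A, h ≤ #{u ∈ A | (G.clusterGraph P ε (δ ^ 2 / 64)).Adj v u}) ∧
      (1 + δ / 2) * k ≤ 2 * h * (Fintype.card V / #P.parts : ℕ) := by
  have hsum := G.sum_degree_le_clusterGraph (P := P) (ε := ε) (d := δ ^ 2 / 64) (γ := δ ^ 2 / 8) hε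
    (by positivity) (by positivity) hP hPu (le_trans (le_of_eq (by field_simp; norm_num)) hm)
  have hmL : #P.parts * (Fintype.card V / #P.parts) ≤ Fintype.card V := Nat.mul_div_le _ _
  have hm0 : (0 : ℝ) < #P.parts := lt_of_lt_of_le (by positivity) hm
  obtain ⟨d, hds, hdl, hd1⟩ := exists_average_of_sum_le hδ hδ1 hεδ hm hL (Nat.cast_nonneg _)
    (Nat.cast_nonneg k) hk (by exact_mod_cast hmL) hdeg hsum
  have hd0 : 0 < d := pos_of_mul_pos_right (lt_of_lt_of_le (by norm_num) hd1) hδ.le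
  have : Nonempty P.parts := by
    obtain ⟨U, hU⟩ := card_pos.1 (show 0 < #P.parts by exact_mod_cast hm0)
    exact ⟨⟨U, hU⟩⟩
  obtain ⟨A, ⟨x, -, hx⟩, hA⟩ := exists_induced_degree
    (R := G.clusterGraph P ε (δ ^ 2 / 64)) d hd0 (by rw [Fintype.card_coe, hds])
  have hfl : (⌊d / 2⌋₊ : ℝ) ≤ d / 2 := Nat.floor_le (half_pos hd0).le
  have hfl' : d / 2 < ⌊d / 2⌋₊ + 1 := Nat.lt_floor_add_one _
  refine ⟨A, x, ⌊d / 2⌋₊, ?_, fun v hv => ?_, ?_⟩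
  · have : ((2 * ⌊d / 2⌋₊ : ℕ) : ℝ) ≤
        (#{u ∈ A | (G.clusterGraph P ε (δ ^ 2 / 64)).Adj x u} : ℝ) := by push_cast; linarith
    exact_mod_cast this
  · exact_mod_cast hfl.trans (hA v hv)
  -- Rounding loses at most 2, and `32 ≤ δ * d` makes this at most `δ * d / 16`.
  · have h1 : (1 - δ / 16) * d ≤ 2 * ⌊d / 2⌋₊ := by linarith
    obtain ⟨l, hl⟩ : ∃ l, l = Fintype.card V / #P.parts := ⟨_, rfl⟩
    rw [← hl] at hdl ⊢
    calc (1 + δ / 2) * k ≤ (1 - δ / 16) * (1 + 5 * δ / 8) * k := by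
          gcongr
          nlinarith
      _ = (1 - δ / 16) * ((1 + 5 * δ / 8) * k) := by ring
      _ ≤ (1 - δ / 16) * (d * l) := mul_le_mul_of_nonneg_left hdl (by linarith)
      _ = (1 - δ / 16) * d * l := by ring
      _ ≤ _ := by gcongr

end SimpleGraph

/-! ### Choice of the parameters -/

/-- The choice of the size of the segments of a tree with maximum degree `Δ`. -/
theorem exists_segment_size {ε : ℝ} {Δ m l k : ℕ} (hε : 0 < ε) (hε1 : ε ≤ 1) (hm : 1 ≤ m)
    (hΔ : 1 ≤ Δ) (hL : 170 * m * (Δ : ℝ) ^ 11 ≤ ε ^ 2 * l) (hk : k ≤ m * (l + 1)) :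
    170 ≤ ε * l ∧ ∃ q : ℕ, 0 < q ∧ ((Δ * q + 1 : ℕ) : ℝ) ≤ ε * l ∧
      ∀ N : ℕ, N * q ≤ k + 1 + q → 10 * ((N : ℝ) * (Δ : ℝ) ^ 10) ≤ ε * l := by
  have hm1 : (1 : ℝ) ≤ m := by exact_mod_cast hm
  have hΔ1 : (1 : ℝ) ≤ Δ := by exact_mod_cast hΔ
  have hl0' : (0 : ℝ) ≤ l := Nat.cast_nonneg l
  have hεl : 170 * m * (Δ : ℝ) ^ 11 ≤ ε * (ε * l) := by rw [sq] at hL; linarith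
  have hεl1 : 170 * m * (Δ : ℝ) ^ 11 ≤ ε * l :=
    hεl.trans (mul_le_of_le_one_left (by positivity) hε1)
  have hΔΔ : (Δ : ℝ) ≤ m * (Δ : ℝ) ^ 11 := by
    calc (Δ : ℝ) = 1 * (Δ : ℝ) ^ 1 := by ring
      _ ≤ _ := by gcongr; norm_num
  have hεl2 : 170 * (Δ : ℝ) ≤ ε * l := by linarith
  have hl0 : (0 : ℝ) < l := pos_of_mul_pos_right (lt_of_lt_of_le (by positivity) hεl2) hε.le
  have hεll : ε * l ≤ 1 * l := by gcongr
  -- Segments may have `Δ * q + 1` vertices, hence the division by `Δ`. It raises the number of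
  -- segments by a factor `Δ`, so that `Δ ^ 10` from the first levels becomes `Δ ^ 11`.
  set q : ℕ := ⌊ε * l / (2 * Δ)⌋₊ with hq
  have hqle : (q : ℝ) * (2 * Δ) ≤ ε * l := by
    rw [← le_div_iff₀ (by positivity)]
    exact Nat.floor_le (by positivity)
  have hqge : ε * l ≤ q * (4 * Δ) := by
    have h1 : ε * l / (2 * Δ) < q + 1 := Nat.lt_floor_add_one _
    rw [div_lt_iff₀ (by positivity)] at h1
    linarith
  refine ⟨by linarith, q, ?_, ?_, fun N hr => ?_⟩
  · rw [Nat.pos_iff_ne_zero]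
    intro h0
    rw [h0] at hqge
    simp only [Nat.cast_zero, zero_mul] at hqge
    linarith
  · push_cast
    linarith
  · have hr' : (N : ℝ) * q ≤ k + 1 + q := by exact_mod_cast hr
    have hn : (k : ℝ) + 1 + q ≤ 2 * m * l + (1 + q) := by
      have h1 : (k : ℝ) ≤ m * (l + 1) := by exact_mod_cast hk
      have h2 : (m : ℝ) * (l + 1) ≤ m * (l + l) := by gcongr; linarith
      linarith
    have hr2 : (N : ℝ) * ε ≤ 17 * m * Δ := by
      have h1 : (N : ℝ) * (ε * l) ≤ N * (q * (4 * Δ)) := by gcongr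
      have h2 : (N : ℝ) * (q * (4 * Δ)) ≤ (2 * m * l + (1 + q)) * (4 * Δ) := by
        rw [← mul_assoc]
        gcongr
        exact hr'.trans hn
      have h3 : (l : ℝ) * 1 ≤ l * (m * Δ) := by
        gcongr
        exact one_le_mul_of_one_le_of_one_le hm1 hΔ1
      refine le_of_mul_le_mul_right ?_ hl0
      linarith
    refine le_of_mul_le_mul_left ?_ hε
    calc ε * (10 * ((N : ℝ) * (Δ : ℝ) ^ 10)) = 10 * (N * ε) * (Δ : ℝ) ^ 10 := by ring
      _ ≤ 10 * (17 * m * Δ) * (Δ : ℝ) ^ 10 := by gcongr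
      _ = 170 * m * (Δ : ℝ) ^ 11 := by ring
      _ ≤ _ := hεl

/-- The choice of the parameters of the greedy embedding into clusters of size `l`. -/
theorem exists_embedding_parameters {δ ε : ℝ} {l p N D h k : ℕ} (hδ : 0 < δ) (hδ1 : δ ≤ 1)
    (hε : ε = δ ^ 3 / 128000) (hl : 170 ≤ ε * l) (hp : (p : ℝ) ≤ ε * l) (hD : 1 ≤ D)
    (hN : 10 * ((N : ℝ) * D) ≤ ε * l) (hh : (1 + δ / 2) * k ≤ 2 * h * l) (hk : 1 < 5 * δ / 16 * k) :
    ∃ θ κ τ c : ℕ, ε * (l + 1) ≤ θ ∧ 0 < θ ∧ (κ : ℝ) ≤ (δ ^ 2 / 64 - ε) * θ ∧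
      (∀ b : ℕ, (b : ℝ) ≤ ε * (l + 1) → b ≤ τ) ∧ 2 * τ + p + N < κ ∧ κ ≤ θ ∧
      k + 1 + h * p < h * (2 * c) ∧ 2 * θ + (c + p + 10 * (N * D)) ≤ l := by
  have hδ2 : δ ^ 2 ≤ δ := by nlinarith
  have hδ3 : δ ^ 3 ≤ δ ^ 2 := by nlinarith [sq_nonneg δ]
  have hε0 : 0 < ε := by rw [hε]; positivity
  have hε1 : 128000 * ε ≤ δ ^ 2 := by rw [hε]; linarith
  have hl0 : (0 : ℝ) < l := pos_of_mul_pos_right (lt_of_lt_of_le (by norm_num) hl) hε0.le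
  have hδl : 128000 * (ε * l) ≤ δ * l := by
    have : 128000 * ε * l ≤ δ * l := by gcongr; linarith
    linarith
  have hN' : (N : ℝ) ≤ N * D := le_mul_of_one_le_right (Nat.cast_nonneg N) (by exact_mod_cast hD)
  have hN0 : (0 : ℝ) ≤ N := Nat.cast_nonneg N
  set θ : ℕ := ⌈δ / 100 * l⌉₊ with hθ
  have hθge : δ / 100 * l ≤ θ := Nat.le_ceil _
  have hθle : (θ : ℝ) ≤ δ / 80 * l := by
    have : (θ : ℝ) < δ / 100 * l + 1 := Nat.ceil_lt_add_one (by positivity)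
    linarith
  -- With `θ` about `δ * l / 100`, the main term `δ ^ 2 / 64 * θ` is about `20 * (ε * l)`, by the
  -- choice of `128000`. This beats `2 * τ + p + N`, where each of `τ`, `p`, `N` is about `ε * l` or
  -- less.
  set κ : ℕ := ⌊(δ ^ 2 / 64 - ε) * θ⌋₊ with hκ
  have hκle : (κ : ℝ) ≤ (δ ^ 2 / 64 - ε) * θ :=
    Nat.floor_le (mul_nonneg (by linarith [sq_nonneg δ]) (Nat.cast_nonneg _))
  have hκge : 19 * (ε * l) - 1 ≤ κ := by
    have h1 : (δ ^ 2 / 64 - ε) * θ < κ + 1 := Nat.lt_floor_add_one _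
    have h2 : 19 * (δ ^ 2 / 64) / 20 * (δ / 100 * l) ≤ (δ ^ 2 / 64 - ε) * θ := by
      gcongr
      · linarith [sq_nonneg δ]
      · linarith
    have h3 : 19 * (δ ^ 2 / 64) / 20 * (δ / 100 * l) = 19 * (ε * l) := by rw [hε]; ring
    linarith
  set τ : ℕ := ⌊ε * (l + 1)⌋₊ with hτ
  have hτle : (τ : ℝ) ≤ ε * (l + 1) := Nat.floor_le (by positivity)
  set c : ℕ := ⌊(1 - δ / 10) * l⌋₊ with hc
  have hcle : (c : ℝ) ≤ (1 - δ / 10) * l :=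
    Nat.floor_le (mul_nonneg (by linarith) hl0.le)
  have hcge : (1 - δ / 10) * l < c + 1 := Nat.lt_floor_add_one _
  refine ⟨θ, κ, τ, c, by linarith, Nat.ceil_pos.2 (by positivity), hκle, fun b hb => Nat.le_floor hb,
    ?_, ?_, ?_, ?_⟩
  · have : ((2 * τ + p + N : ℕ) : ℝ) < κ := by push_cast; linarith
    exact_mod_cast this
  · have : (κ : ℝ) ≤ θ := hκle.trans (mul_le_of_le_one_left (Nat.cast_nonneg _) (by linarith))
    exact_mod_cast this
  · have h1 : (1 - δ / 8) * (2 * l) ≤ 2 * c - p := by linarith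
    have h2 : ((k + 1 + h * p : ℕ) : ℝ) < (h * (2 * c) : ℕ) := by
      push_cast
      have h3 : (h : ℝ) * ((1 - δ / 8) * (2 * l)) ≤ h * (2 * c - p) := by gcongr
      have h4 : (1 - δ / 8) * ((1 + δ / 2) * k) ≤ (1 - δ / 8) * (2 * h * l) :=
        mul_le_mul_of_nonneg_left hh (by linarith)
      have h5 : (1 + 5 * δ / 16) * k ≤ (1 - δ / 8) * (1 + δ / 2) * k := by
        gcongr
        linarith
      linarith
    exact_mod_cast h2
  · have : ((2 * θ + (c + p + 10 * (N * D)) : ℕ) : ℝ) ≤ l := by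
      push_cast
      linarith
    exact_mod_cast this

/-! ### Assembling the proof -/

namespace SimpleGraph.IsTree

/-- Embedding of a tree of small maximum degree into a graph with a uniform equipartition. -/
theorem isContained_of_isUniform {V W : Type*} [DecidableEq V] [Fintype V] [Fintype W]
    {G : SimpleGraph V} [DecidableRel G.Adj] {T : SimpleGraph W} [DecidableRel T.Adj]
    (hT : T.IsTree) {δ ε : ℝ} {k : ℕ} (hδ : 0 < δ) (hδ1 : δ ≤ 1) (hε : ε = δ ^ 3 / 128000)
    (hk : T.edgeFinset.card = k) (hk0 : 0 < k) (hkn : k ≤ Fintype.card V)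
    (hδk : δ * Fintype.card V ≤ k) (hdeg : (1 + δ) * k * Fintype.card V < ∑ v, (G.degree v : ℝ))
    {P : Finpartition (univ : Finset V)} (hP : P.IsEquipartition) (hPu : P.IsUniform G ε)
    (hm : 32 / δ ^ 2 ≤ #P.parts)
    (hL : 170 * #P.parts * (T.maxDegree : ℝ) ^ 11 ≤
      ε ^ 2 * (Fintype.card V / #P.parts : ℕ)) :
    T.IsContained G := by
  classical
  have : Nonempty V := Fintype.card_pos_iff.1 (by omega)
  have hm0 : 0 < #P.parts := by
    have : (0 : ℝ) < #P.parts := lt_of_lt_of_le (by positivity) hm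
    exact_mod_cast this
  have hWk : Fintype.card W = k + 1 := by rw [← hk, hT.card_edgeFinset]
  have hΔ : 1 ≤ T.maxDegree := by
    obtain ⟨e, he⟩ : T.edgeFinset.Nonempty := card_pos.1 (by omega)
    induction e using Sym2.ind with
    | _ u v =>
      rw [mem_edgeFinset, mem_edgeSet] at he
      exact ((T.degree_pos_iff_exists_adj u).2 ⟨v, he⟩).trans_le (T.degree_le_maxDegree u)
  have hmL := Nat.lt_mul_div_succ (Fintype.card V) hm0
  have hLn : Fintype.card V / #P.parts ≤ Fintype.card V := Nat.div_le_self _ _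
  have hsize := fun (U : P.parts) => hP.average_le_card_part U.2
  have hsize' := fun (U : P.parts) => hP.card_part_le_average_add_one U.2
  rw [card_univ] at hsize hsize'
  have hε0 : 0 < ε := by rw [hε]; positivity
  have hδ2 : δ ^ 2 ≤ δ := by nlinarith
  have hδ3 : δ ^ 3 ≤ δ ^ 2 := by nlinarith [sq_nonneg δ]
  have hε1 : 128000 * ε ≤ δ ^ 2 := by rw [hε]; linarith
  have hdense := fun h => G.exists_dense_clusters (P := P) (ε := ε) (k := k) hδ hδ1 hε0
    (by linarith) hP hPu hm h hδk hdeg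
  obtain ⟨l, hl⟩ : ∃ l, l = Fintype.card V / #P.parts := ⟨_, rfl⟩
  rw [← hl] at hmL hLn hsize hsize' hdense hL
  obtain ⟨hεl, q, hq0, hp, hN⟩ := exists_segment_size hε0 (by linarith) hm0 hΔ hL
    (hkn.trans hmL.le)
  have hεδl : 128000 * (ε * l) ≤ δ * (δ * l) := by
    calc 128000 * (ε * l) = 128000 * ε * l := by ring
      _ ≤ δ ^ 2 * l := by gcongr
      _ = _ := by ring
  have hδl : δ * (δ * l) ≤ δ * l := mul_le_of_le_one_left (by positivity) hδ1
  obtain ⟨A, x, h, hx, hA, hh⟩ := hdense (by rw [div_le_iff₀ hδ]; linarith)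
  obtain ⟨S, num, hSn, hinj, hnum, hadj, hSdeg, hSp, hSr⟩ := hT.exists_segmentedTree q hq0
  rw [hWk] at hSn
  have hk1 : 1 < 5 * δ / 16 * k := by
    have h1 : δ * l ≤ k := le_trans (by gcongr) hδk
    have h2 : δ * (δ * l) ≤ δ * k := by gcongr
    linarith
  obtain ⟨θ, κ, τ, c, hθ, hθ0, hκ, hτ, h1, h2, h3, h4⟩ := exists_embedding_parameters
    (D := T.maxDegree ^ 10) hδ hδ1 hε hεl hp (Nat.one_le_pow _ _ hΔ)
    (by push_cast; exact hN _ (by rw [hSn] at hSr; exact hSr)) hh hk1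
  rw [← hSn] at h3
  have hcl : ∀ U U' : P.parts, (G.clusterGraph P ε (δ ^ 2 / 64)).Adj U U' → ∀ B ⊆ U'.1, θ ≤ #B →
      #{v ∈ U.1 | #{u ∈ B | G.Adj v u} < κ} ≤ τ := by
    rintro U U' ⟨-, hunif, hdens⟩ B hB hθB
    have hU : (#U.1 : ℝ) * ε ≤ ε * (l + 1) := by
      rw [mul_comm]
      gcongr
      exact_mod_cast hsize' U
    have hU' : (#U'.1 : ℝ) * ε ≤ ε * (l + 1) := by
      rw [mul_comm]
      gcongr
      exact_mod_cast hsize' U'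
    have hθB' : (θ : ℝ) ≤ #B := by exact_mod_cast hθB
    exact hτ _ ((hunif.card_low_degree_le hdens hB (by linarith) (by omega) (hκ.trans
      (mul_le_mul_of_nonneg_left hθB' (by linarith [sq_nonneg δ])))).trans hU)
  obtain ⟨f, hf, hfadj⟩ := S.exists_embedding_of_reduced G (fun U : P.parts => U.1)
    (fun U U' hne => P.disjoint U.2 U'.2 (fun h => hne (Subtype.ext h)))
    (G.clusterGraph P ε (δ ^ 2 / 64)) θ κ τ _ #S.roots T.maxDegree c h hcl h1 h2 A x hx hA hSp
    le_rfl hΔ hSdeg h3 (fun U => h4.trans (hsize U))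
  refine ⟨⟨⟨fun w => f (num w), fun {u v} huv => ?_⟩, fun u v huv => ?_⟩⟩
  · rcases hadj u v huv with ⟨h0, h1⟩ | ⟨h0, h1⟩
    · rw [← h1]; exact (hfadj _ h0 (hnum u)).symm
    · rw [← h1]; exact hfadj _ h0 (hnum v)
  · exact hinj (hf (hnum u) (hnum v) huv)

end SimpleGraph.IsTree

theorem theorem1p9 (δ : ℝ) (hδ : 0 < δ) :
    ∃ n₀ : ℕ, ∀ n k : ℕ, n₀ ≤ n → k ≤ n → δ * (n : ℝ) ≤ (k : ℝ) →
      ∀ (V : Type*) [Fintype V] (G : SimpleGraph V) [DecidableRel G.Adj],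
        Fintype.card V = n → (1 + δ) * (k : ℝ) < avgDegree G →
        ∀ (W : Type*) [Fintype W] (T : SimpleGraph W) [DecidableRel T.Adj],
          T.IsTree → T.edgeFinset.card = k →
          (T.maxDegree : ℝ) ≤ (k : ℝ) ^ ((1 : ℝ) / 67) →
          T.IsContained G := by
  -- The estimates above need `δ ≤ 1`; both hypotheses involving `δ` only weaken when it decreases.
  set η : ℝ := min δ 1 with hη
  have hη0 : 0 < η := lt_min hδ one_pos
  have hηδ : η ≤ δ := min_le_left _ _
  set ε : ℝ := η ^ 3 / 128000 with hε
  have hε0 : 0 < ε := by positivity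
  set m₀ : ℕ := ⌈32 / η ^ 2⌉₊
  set M : ℕ := SzemerediRegularity.bound ε m₀
  set c : ℕ := ⌈340 * (M : ℝ) ^ 2 / ε ^ 2⌉₊
  refine ⟨max (c ^ 12) (max m₀ 1), ?_⟩
  intro n k hn hkn hδk V _ G _ hV hdeg W _ T _ hT hTk hΔ
  classical
  have hn1 : c ^ 12 ≤ n := (le_max_left _ _).trans hn
  have hn2 : m₀ ≤ n := ((le_max_left _ _).trans (le_max_right _ _)).trans hn
  have hn3 : 1 ≤ n := ((le_max_right _ _).trans (le_max_right _ _)).trans hn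
  have hn0 : (0 : ℝ) < n := by exact_mod_cast hn3
  subst hV
  have hk0 : 0 < k := by
    have : (0 : ℝ) < k := lt_of_lt_of_le (by positivity) hδk
    exact_mod_cast this
  obtain ⟨P, hP, hPm, hPM, hPu⟩ := szemeredi_regularity G hε0 hn2
  have hm : 32 / η ^ 2 ≤ #P.parts := (Nat.le_ceil _).trans (by exact_mod_cast hPm)
  have hm0 : (0 : ℝ) < #P.parts := lt_of_lt_of_le (by positivity) hm
  refine hT.isContained_of_isUniform hη0 (min_le_right _ _) hε hTk hk0 hkn
    (le_trans (by gcongr) hδk) ?_ hP hPu hm ?_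
  · rw [avgDegree, lt_div_iff₀ hn0] at hdeg
    refine lt_of_le_of_lt ?_ hdeg
    gcongr
  · have hΔk : T.maxDegree ^ 67 ≤ Fintype.card V := by
      refine le_trans ?_ hkn
      have h1 : (T.maxDegree : ℝ) ^ 67 ≤ ((k : ℝ) ^ ((1 : ℝ) / 67)) ^ 67 := by gcongr
      rw [← Real.rpow_natCast, ← Real.rpow_natCast, ← Real.rpow_mul (Nat.cast_nonneg k)] at h1
      norm_num at h1
      exact_mod_cast h1
    -- For small `Δ` this follows from `c ^ 12 ≤ n`, and for `c ≤ Δ` from `Δ ^ 12 ≤ n`. The exponent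
    -- 67 is thus far more than this argument needs.
    have hcΔ : c * T.maxDegree ^ 11 ≤ Fintype.card V := by
      rcases le_total T.maxDegree c with h | h
      · calc c * T.maxDegree ^ 11 ≤ c * c ^ 11 := by gcongr
          _ = c ^ 12 := by ring
          _ ≤ _ := hn1
      · rcases Nat.eq_zero_or_pos T.maxDegree with h0 | h0
        · simp [h0]
        · calc c * T.maxDegree ^ 11 ≤ T.maxDegree * T.maxDegree ^ 11 := by gcongr
            _ = T.maxDegree ^ 12 := by ring
            _ ≤ T.maxDegree ^ 67 := Nat.pow_le_pow_right h0 (by norm_num)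
            _ ≤ _ := hΔk
    have hhalf : (Fintype.card V : ℝ) ≤ 2 * #P.parts * (Fintype.card V / #P.parts : ℕ) := by
      have h1 : 0 < #P.parts := by exact_mod_cast hm0
      have h2 : #P.parts ≤ Fintype.card V := P.card_parts_le_card
      have h3 : 1 ≤ Fintype.card V / #P.parts := (Nat.one_le_div_iff h1).2 h2
      have h4 : Fintype.card V < #P.parts * (Fintype.card V / #P.parts + 1) :=
        Nat.lt_mul_div_succ _ h1
      have h5 : Fintype.card V ≤ 2 * #P.parts * (Fintype.card V / #P.parts) := by nlinarith
      exact_mod_cast h5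
    have hc : 340 * (M : ℝ) ^ 2 ≤ c * ε ^ 2 := by
      rw [← div_le_iff₀ (by positivity)]
      exact Nat.le_ceil _
    have hmM : (#P.parts : ℝ) ≤ M := by exact_mod_cast hPM
    have hcΔ' : (c : ℝ) * (T.maxDegree : ℝ) ^ 11 ≤ Fintype.card V := by exact_mod_cast hcΔ
    refine le_of_mul_le_mul_left ?_ (show (0 : ℝ) < 2 * #P.parts by positivity)
    calc 2 * (#P.parts : ℝ) * (170 * #P.parts * (T.maxDegree : ℝ) ^ 11)
        = 340 * (#P.parts : ℝ) ^ 2 * (T.maxDegree : ℝ) ^ 11 := by ring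
      _ ≤ 340 * (M : ℝ) ^ 2 * (T.maxDegree : ℝ) ^ 11 := by gcongr
      _ ≤ c * ε ^ 2 * (T.maxDegree : ℝ) ^ 11 := by gcongr
      _ = ε ^ 2 * (c * (T.maxDegree : ℝ) ^ 11) := by ring
      _ ≤ ε ^ 2 * (2 * #P.parts * (Fintype.card V / #P.parts : ℕ)) :=
        mul_le_mul_of_nonneg_left (hcΔ'.trans hhalf) (by positivity)
      _ = _ := by ring
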